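/- **Setting.** Fix $d\ge 1$. For $i=0,\dots,m$ let $P_i$ be a probability law of $(X,Y)\in\mathbb R^d\times\{0,1\}$ with regression function $\eta_i(x)=P_i(Y=1\mid X=x)$; $P_0$ is the expert (ground truth) distribution and $P_1,\dots,P_m$ are the workers' distributions. Let $\gamma=(\gamma_0,\dots,\gamma_m)$ with $\gamma_i>0$, $\gamma_0=1$, and let $C_{\gamma_i}>0$, $C_{\gamma_0}=1$. Say that $(P_0,\dots,P_m)$ is *regular* if (i) all marginals $P_{i,X}$ have the same support $\Omega$ and are absolutely continuous with densities between $\mu_-$ and $\mu_+$ (strictly) almost everywhere on $\Omega$, and $\lambda(\Omega\cap B(x,r))\ge c_\mu\lambda(B(x,r))$ for all $x\in\Omega$, $0<r\le r_\mu$; (ii) $|\eta_0(x)-\eta_0(x')|\le C_\beta\|x-x'\|^\beta$ for $x,x'\in\Omega$; (iii) $P_0(|\eta_0(X)-\tfrac12|\le t)\le C_\alpha t^\alpha$ for all $t>0$. Let $\Pi=\Pi(\alpha,\beta,\gamma,\mu)$ be the set of regular $(P_0,\dots,P_m)$ such that on $\Omega$ each worker has flipping rates $a_i=b_i=\tfrac12\big[1+C_{\gamma_i}|\eta_0-\tfrac12|^{\gamma_i-1}\big]$,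 that is, $\eta_i=a_i\eta_0+(1-b_i)(1-\eta_0)=\tfrac12+C_{\gamma_i}|\eta_0-\tfrac12|^{\gamma_i-1}(\eta_0-\tfrac12)$. Let $\Pi'\supseteq\Pi$ be the set of regular $(P_0,\dots,P_m)$ with only $(\eta_i-\tfrac12)(\eta_0-\tfrac12)\ge0$ and $|\eta_i-\tfrac12|\ge C_{\gamma_i}|\eta_0-\tfrac12|^{\gamma_i}$ on $\Omega$ for all $i$. From each $P_i$ one observes $n_i$ observations, all observations being independent. Put $$N=\sum_{i=0}^m n_i^{\frac{2\beta+d}{2\gamma_i\beta+d}},\qquad k_i=\big\lfloor n_iN^{-\frac{d}{2\beta+d}}\big\rfloor,\qquad w_i=N^{-\frac{\gamma_i\beta}{2\beta+d}} .$$ With $Y^i_{(j)}(x)$ the label of the $j$-th nearest neighbour of $x$ in sample $i$ (ties broken by index), the VSNN classifier is $\widehat f(x)=\mathbf 1\{\widehat\eta(x)>1/2\}$, $\widehat\eta(x)=\sum_{i=0}^m w_i\sum_{j=1}^{k_i}Y^i_{(j)}(x)\big/\sum_{i=0}^m w_ik_i$. Its excess risk is $\mathcal E_0(\widehat f)=P_0(Y\ne\widehat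 f(X))-\inf_f P_0(Y\ne f(X))$, the infimum being over measurable classifiers. **Theorem (Upper Bound).** Let $\alpha\ge 0$; let $\beta,C_\alpha,C_\beta,c_\mu,r_\mu,\gamma_*,c_*>0$, $0<\mu_-<\mu_+$ and $0<C_L<C_U<\infty$. There are constants $C>0$ and $\varepsilon>0$ depending only on these numbers and on $d$ (so not on $m$, on the $n_i$, $\gamma_i$, $C_{\gamma_i}$, or on the distributions) such that the following holds for all $m\ge 0$, all $\gamma_i\ge\gamma_*$ and $C_{\gamma_i}\ge c_*$ (with $\gamma_0=C_{\gamma_0}=1$), and all $n_0,\dots,n_m$ satisfying the sample-size condition $$C_L<\sum_{i=0}^m\frac{n_i}{\Big(\sum_{l=0}^m n_l^{\frac{2\beta+d}{2\gamma_l\beta+d}}\Big)^{\frac{2\gamma_i\beta+d}{2\beta+d}}}<C_U .$$ 1. If the condition also survives the rounding in $k_i$, that is, $C_L<\sum_{i=0}^m k_iw_i^2$, then $$\sup_{(P_0,\dots,P_m)\in\Pi}\mathbb E\,\mathcal E_0(\widehat f)\le C\Big(\sum_{i=0}^m n_i^{\frac{2\beta+d}{2\gamma_i\beta+d}}\Big)^{-\frac{\beta(1+\alpha)}{2\beta+d}}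 .$$ 2. If $\sum_{i=0}^m w_i\le\varepsilon$ (for fixed $m$ and $\gamma$ this holds as soon as all $n_i$ are large enough), then the same bound holds for the supremum over the larger class $\Pi'$. In both cases $\mathcal E_0(\widehat f)$ is an integrable random variable. -/

import Mathlib

open MeasureTheory Set

noncomputable section

/-- A labelled observation `(X, Y)` with `X ∈ ℝ^d` and a binary label `Y` (`true` is `1`). -/
abbrev Obs (d : ℕ) : Type := EuclideanSpace ℝ (Fin d) × Bool

/-- A crowdsourcing sample: `n i` observations from source `i`, for `i = 0, …, m`
(source `0` is the expert, sources `1, …, m` are the workers). -/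
abbrev CrowdSample (d m : ℕ) (n : Fin (m + 1) → ℕ) : Type :=
  (i : Fin (m + 1)) → Fin (n i) → Obs d

/-- The law of the sample: all observations are independent, those of source `i` have law `P i`. -/
def crowdLaw {d m : ℕ} (n : Fin (m + 1) → ℕ) (P : Fin (m + 1) → Measure (Obs d)) :
    Measure (CrowdSample d m n) :=
  Measure.pi fun i => Measure.pi fun _ : Fin (n i) => P i

/-! ### Distributions -/

/-- `η` is a regression function of `P`, a version of `x ↦ P(Y = 1 | X = x)`. -/
structure IsRegressionFunction {d : ℕ} (P : Measure (Obs d))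
    (η : EuclideanSpace ℝ (Fin d) → ℝ) : Prop where
  measurable : Measurable η
  mem_unit : ∀ x, η x ∈ Icc (0 : ℝ) 1
  prob_true : ∀ A : Set (EuclideanSpace ℝ (Fin d)), MeasurableSet A →
    P (A ×ˢ {true}) = ∫⁻ x in A, ENNReal.ofReal (η x) ∂P.fst

/-- Smoothness of `η 0`, the margin condition, and the strong density and common support
condition, for probability laws `P 0, …, P m` with regression functions `η 0, …, η m`. -/
structure IsRegularCrowd {d m : ℕ} (α β Cα Cβ μlo μhi cμ rμ : ℝ) (P : Fin (m + 1) → Measure (Obs d))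
    (η : Fin (m + 1) → EuclideanSpace ℝ (Fin d) → ℝ) : Prop where
  prob : ∀ i, IsProbabilityMeasure (P i)
  regression : ∀ i, IsRegressionFunction (P i) (η i)
  smooth : ∀ x ∈ (P 0).fst.support, ∀ x' ∈ (P 0).fst.support,
    |η 0 x - η 0 x'| ≤ Cβ * ‖x - x'‖ ^ β
  margin : ∀ t : ℝ, 0 < t → (P 0).fst.real {x | |η 0 x - 1 / 2| ≤ t} ≤ Cα * t ^ α
  common_support : ∀ i, (P i).fst.support = (P 0).fst.support
  abs_cont : ∀ i, (P i).fst ≪ volume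
  regular_support : ∀ x ∈ (P 0).fst.support, ∀ r : ℝ, 0 < r → r ≤ rμ →
    ENNReal.ofReal cμ * volume (Metric.ball x r) ≤ volume ((P 0).fst.support ∩ Metric.ball x r)
  density : ∀ i, ∀ᵐ x ∂(volume.restrict (P 0).fst.support),
    ENNReal.ofReal μlo < (P i).fst.rnDeriv volume x ∧
      (P i).fst.rnDeriv volume x < ENNReal.ofReal μhi

/-- The accuracy `a(x) = b(x) = (1 + C |u - 1/2| ^ (γ - 1)) / 2` of a worker at a point where the
true regression function has the value `u`. -/
def workerAccuracy (C γ u : ℝ) : ℝ := (1 + C * |u - 1 / 2| ^ (γ - 1)) / 2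

/-- The regression function `a u + (1 - b) (1 - u)` of a worker with `P(Y = 1 | Y⁰ = 1) = a` and
`P(Y = 0 | Y⁰ = 0) = b`. -/
def flippedRegression (a b u : ℝ) : ℝ := a * u + (1 - b) * (1 - u)

/-- Crowdsourcing distributions `(P 0, …, P m)` in the flipping-rate model with parameters `γ i`
and constants `Cγ i`. -/
def FlipClass {d m : ℕ} (α β Cα Cβ μlo μhi cμ rμ : ℝ) (γ Cγ : Fin (m + 1) → ℝ) :
    Set (Fin (m + 1) → Measure (Obs d)) :=
  {P | ∃ η : Fin (m + 1) → EuclideanSpace ℝ (Fin d) → ℝ,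
    IsRegularCrowd α β Cα Cβ μlo μhi cμ rμ P η ∧
    ∀ i, ∀ x ∈ (P 0).fst.support,
      η i x = flippedRegression (workerAccuracy (Cγ i) (γ i) (η 0 x))
        (workerAccuracy (Cγ i) (γ i) (η 0 x)) (η 0 x)}

/-- Crowdsourcing distributions `(P 0, …, P m)` in the posterior drift model: the workers' signals
have the sign of the expert's signal and at least the relative strength given by `γ i`, `Cγ i`. -/
def DriftClass {d m : ℕ} (α β Cα Cβ μlo μhi cμ rμ : ℝ) (γ Cγ : Fin (m + 1) → ℝ) :
    Set (Fin (m + 1) → Measure (Obs d)) :=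
  {P | ∃ η : Fin (m + 1) → EuclideanSpace ℝ (Fin d) → ℝ,
    IsRegularCrowd α β Cα Cβ μlo μhi cμ rμ P η ∧
    ∀ i, ∀ x ∈ (P 0).fst.support,
      0 ≤ (η i x - 1 / 2) * (η 0 x - 1 / 2) ∧
      Cγ i * |η 0 x - 1 / 2| ^ γ i ≤ |η i x - 1 / 2|}

/-! ### Excess risk -/

/-- The misclassification risk `P(f(X) ≠ Y)`. -/
def misclassRisk {d : ℕ} (P : Measure (Obs d)) (f : EuclideanSpace ℝ (Fin d) → Bool) : ℝ :=
  P.real {z | f z.1 ≠ z.2}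

/-- The excess risk of `f`: its risk minus the smallest risk of a measurable classifier. -/
def excessRisk {d : ℕ} (P : Measure (Obs d)) (f : EuclideanSpace ℝ (Fin d) → Bool) : ℝ :=
  misclassRisk P f - ⨅ g : {g : EuclideanSpace ℝ (Fin d) → Bool // Measurable g}, misclassRisk P g.1

/-! ### The classifier -/

/-- `∑ i, n i ^ ((2β + d) / (2 γ i β + d))`. -/
def effSize {m : ℕ} (d : ℕ) (β : ℝ) (γ : Fin (m + 1) → ℝ) (n : Fin (m + 1) → ℕ) : ℝ :=
  ∑ i, (n i : ℝ) ^ ((2 * β + d) / (2 * γ i * β + d))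

/-- The number of neighbours `k i`. -/
def numNeighbors {m : ℕ} (d : ℕ) (β : ℝ) (γ : Fin (m + 1) → ℝ) (n : Fin (m + 1) → ℕ)
    (i : Fin (m + 1)) : ℕ :=
  ⌊(n i : ℝ) * effSize d β γ n ^ (-((d : ℝ) / (2 * β + d)))⌋₊

/-- The voting weight `w i`. -/
def voteWeight {m : ℕ} (d : ℕ) (β : ℝ) (γ : Fin (m + 1) → ℝ) (n : Fin (m + 1) → ℕ)
    (i : Fin (m + 1)) : ℝ :=
  effSize d β γ n ^ (-(γ i * β / (2 * β + d)))

open Classical in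
/-- The number of data points that come before `X j` when the data are listed by increasing
distance to `x`, ties being broken by the index. -/
def distRank {d N : ℕ} (s : Fin N → Obs d) (x : EuclideanSpace ℝ (Fin d)) (j : Fin N) : ℕ :=
  (Finset.univ.filter fun l : Fin N =>
    dist (s l).1 x < dist (s j).1 x ∨ (dist (s l).1 x = dist (s j).1 x ∧ l < j)).card

/-- The sum `Y_(1)(x) + … + Y_(k)(x)` of the labels of the `k` nearest neighbours of `x`. -/
def neighborLabelSum {d N : ℕ} (s : Fin N → Obs d) (k : ℕ) (x : EuclideanSpace ℝ (Fin d)) : ℝ :=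
  ∑ j : Fin N, if distRank s x j < k then (if (s j).2 = true then 1 else 0) else 0

/-- The estimated regression function of the voting-second nearest neighbour method. -/
def vsnnRegression {d m : ℕ} (β : ℝ) (γ : Fin (m + 1) → ℝ) (n : Fin (m + 1) → ℕ)
    (s : CrowdSample d m n) (x : EuclideanSpace ℝ (Fin d)) : ℝ :=
  (∑ i, voteWeight d β γ n i * neighborLabelSum (s i) (numNeighbors d β γ n i) x) /
    ∑ i, voteWeight d β γ n i * (numNeighbors d β γ n i : ℝ)

open Classical in
/-- The voting-second nearest neighbour (VSNN) classifier. -/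
def vsnn {d m : ℕ} (β : ℝ) (γ : Fin (m + 1) → ℝ) (n : Fin (m + 1) → ℕ)
    (s : CrowdSample d m n) (x : EuclideanSpace ℝ (Fin d)) : Bool :=
  decide (1 / 2 < vsnnRegression β γ n s x)

/-- The expected excess risk of the VSNN classifier exists and is at most `b`, for all
distributions in the class `Q`. -/
def WorstCaseExcessRiskLE {d m : ℕ} (β : ℝ) (γ : Fin (m + 1) → ℝ) (n : Fin (m + 1) → ℕ)
    (Q : Set (Fin (m + 1) → Measure (Obs d))) (b : ℝ) : Prop :=
  ∀ P ∈ Q,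
    Integrable (fun s => excessRisk (P 0) (vsnn β γ n s)) (crowdLaw n P) ∧
    ∫ s, excessRisk (P 0) (vsnn β γ n s) ∂(crowdLaw n P) ≤ b

/-- The sample-size functional `∑ i, n i / N ^ ((2 γ i β + d) / (2β + d))`, `N` the effective
size. -/
def sizeRatio {m : ℕ} (d : ℕ) (β : ℝ) (γ : Fin (m + 1) → ℝ) (n : Fin (m + 1) → ℕ) : ℝ :=
  ∑ i, (n i : ℝ) / effSize d β γ n ^ ((2 * γ i * β + d) / (2 * β + d))

end

/-! ### Ranks by distance -/

section Rank

variable {d N : ℕ}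

/-! Put `δ = N ^ (-β / (2β + d))`, where `N` is the effective size. Then `w i = δ ^ γ i`, `k i` is
`n i * δ ^ (d / β)` rounded down, and the sample-size functional is `V = ∑ k i * w i ^ 2` before
rounding. Everything reduces to one pointwise claim: if `t = |η 0 x - 1/2|` and `ρ = t / δ`, the
vote at `x` is wrong with probability at most `C * ρ ^ (-K)` for a suitable large `K`
(`exists_vote_error_le`). Slicing dyadically in `t`, the margin condition turns this into the rate
`δ ^ (1 + α)` (`lintegral_le_of_margin`).

For the claim, Hölder continuity keeps `η 0` within `t / 2` of `η 0 x` on the ball of radius `κ * t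
^ (1 / β)`. Each neighbour from source `i` in that ball has mean signal at least `g i = Cγ i * (t /
2) ^ γ i`, which is at least `Cγlo * w i * (ρ / 2) ^ γlo` once `ρ ≥ 2`. So the total signal `G = ∑ w
i * k i * g i` is at least a constant times `ρ ^ γlo * V`, and Hoeffding's inequality given the
covariates bounds the error by `exp (-G ^ 2 / (2 V))`.

The remaining difficulty is neighbours outside the ball. A Chernoff bound makes them unlikely for
each source, but a union bound would cost a factor depending on `m`. Instead the signal they lose is
added back to the vote (`farBias`), and its weighted expectation is compared with `G` by Markov's
inequality (`crowdLaw_vote_le`). A source whose signal is a bounded power of the expert's loses only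
a fraction `ρ ^ (-K)` of its own share of `G`, up to constants (`lintegral_farBias_le_of_power`).
Any other source costs at most a constant times `w i * ρ ^ (-K)`, which is affordable when these
weights sum to at most `1`. In the flipping model this holds automatically for the large exponents
(`sum_voteWeight_le_one`); in the drift model it is the assumption on `∑ w i`. -/

theorem distRank_lt (s : Fin N → Obs d) (x : EuclideanSpace ℝ (Fin d)) (j : Fin N) :
    distRank s x j < N := by
  classical
  unfold distRank
  calc _ < (Finset.univ : Finset (Fin N)).card := by
        apply Finset.card_lt_card
        rw [Finset.ssubset_univ_iff]
        intro h
        have := Finset.mem_univ j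
        rw [← h] at this
        simp at this
    _ = N := by simp

theorem distRank_lt_distRank (s : Fin N → Obs d) (x : EuclideanSpace ℝ (Fin d)) {i j : Fin N}
    (h : dist (s i).1 x < dist (s j).1 x ∨ (dist (s i).1 x = dist (s j).1 x ∧ i < j)) :
    distRank s x i < distRank s x j := by
  classical
  unfold distRank
  apply Finset.card_lt_card
  rw [Finset.ssubset_iff_of_subset]
  · exact ⟨i, by simpa using h, by simp⟩
  · intro l hl
    simp only [Finset.mem_filter, Finset.mem_univ, true_and] at hl ⊢
    rcases h with h | ⟨h, hij⟩ <;> rcases hl with hl | ⟨hl, hli⟩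
    · exact Or.inl (hl.trans h)
    · exact Or.inl (hl ▸ h)
    · exact Or.inl (h ▸ hl)
    · exact Or.inr ⟨hl.trans h, hli.trans hij⟩

theorem distRank_injective (s : Fin N → Obs d) (x : EuclideanSpace ℝ (Fin d)) :
    Function.Injective (distRank s x) := by
  intro i j hij
  by_contra hne
  rcases lt_trichotomy (dist (s i).1 x) (dist (s j).1 x) with h | h | h
  · exact (distRank_lt_distRank s x (Or.inl h)).ne hij
  · rcases lt_or_gt_of_ne hne with h' | h'
    · exact (distRank_lt_distRank s x (Or.inr ⟨h, h'⟩)).ne hij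
    · exact (distRank_lt_distRank s x (Or.inr ⟨h.symm, h'⟩)).ne' hij
  · exact (distRank_lt_distRank s x (Or.inl h)).ne' hij

/-- Ranks are injective into `Fin N`, hence a bijection, so tie-breaking yields exactly `k`
neighbours. The exponential moments therefore have exactly `k` nontrivial factors. -/
theorem card_distRank_lt (s : Fin N → Obs d) (x : EuclideanSpace ℝ (Fin d)) {k : ℕ} (hk : k ≤ N) :
    (Finset.univ.filter fun j => distRank s x j < k).card = k := by
  classical
  let e : Fin N → Fin N := fun j => ⟨distRank s x j, distRank_lt s x j⟩
  have he : Function.Bijective e := by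
    rw [← Finite.injective_iff_bijective]
    intro i j hij
    exact distRank_injective s x (by simpa [e] using hij)
  have h1 : (Finset.univ.filter fun j => distRank s x j < k).map ⟨e, he.1⟩
      = Finset.univ.filter fun l : Fin N => (l : ℕ) < k := by
    ext l
    obtain ⟨j, rfl⟩ := he.2 l
    simp only [Finset.mem_map, Finset.mem_filter, Finset.mem_univ, true_and,
      Function.Embedding.coeFn_mk]
    constructor
    · rintro ⟨i, hi, hij⟩
      rw [← hij]
      exact hi
    · intro h
      exact ⟨j, h, rfl⟩
  rw [← Finset.card_map ⟨e, he.1⟩, h1, Fin.card_filter_val_lt, min_eq_right hk]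

/-- All points of the open ball precede `j` in the ranking. A selected neighbour outside a ball thus
reveals that the ball holds too few points. -/
theorem card_dist_lt_of_distRank_lt (s : Fin N → Obs d) (x : EuclideanSpace ℝ (Fin d)) {k : ℕ}
    {j : Fin N} {r : ℝ} (hj : distRank s x j < k) (hr : r ≤ dist (s j).1 x) :
    (Finset.univ.filter fun l => dist (s l).1 x < r).card < k := by
  classical
  refine lt_of_le_of_lt (Finset.card_le_card ?_) hj
  intro l hl
  simp only [Finset.mem_filter, Finset.mem_univ, true_and] at hl ⊢
  exact Or.inl (hl.trans_le hr)

/-- Ranks do not see the labels, so the selected set stays fixed when the labels are averaged out.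
-/
theorem distRank_congr {s s' : Fin N → Obs d} (h : ∀ j, (s j).1 = (s' j).1)
    (x : EuclideanSpace ℝ (Fin d)) (j : Fin N) : distRank s x j = distRank s' x j := by
  simp only [distRank, h]

theorem measurable_distRank (j : Fin N) :
    Measurable fun p : (Fin N → Obs d) × EuclideanSpace ℝ (Fin d) => distRank p.1 p.2 j := by
  classical
  simp only [distRank, Finset.card_filter]
  refine Finset.measurable_sum _ fun l _ => Measurable.ite ?_ measurable_const measurable_const
  have hd : ∀ l : Fin N, Measurable fun p : (Fin N → Obs d) × EuclideanSpace ℝ (Fin d) =>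
      dist (p.1 l).1 p.2 := fun l => by fun_prop
  exact (measurableSet_lt (hd l) (hd j)).union
    ((measurableSet_eq_fun (hd l) (hd j)).inter (.const _))

theorem measurable_neighborLabelSum (k : ℕ) :
    Measurable fun p : (Fin N → Obs d) × EuclideanSpace ℝ (Fin d) =>
      neighborLabelSum p.1 k p.2 := by
  unfold neighborLabelSum
  refine Finset.measurable_sum _ fun j _ => Measurable.ite ?_ (Measurable.ite ?_ ?_ ?_) ?_
  · exact measurableSet_lt (measurable_distRank j) measurable_const
  · exact measurableSet_eq_fun (by fun_prop) measurable_const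
  all_goals exact measurable_const

end Rank

/-- Joint measurability is needed to exchange the integrals over the sample and over the test point.
-/
theorem measurable_vsnn {d m : ℕ} (β : ℝ) (γ : Fin (m + 1) → ℝ) (n : Fin (m + 1) → ℕ) :
    Measurable fun p : CrowdSample d m n × EuclideanSpace ℝ (Fin d) => vsnn β γ n p.1 p.2 := by
  have h : Measurable fun p : CrowdSample d m n × EuclideanSpace ℝ (Fin d) =>
      vsnnRegression β γ n p.1 p.2 := by
    unfold vsnnRegression
    refine Measurable.div_const (Finset.measurable_sum _ fun i _ => Measurable.const_mul ?_ _) _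
    exact (measurable_neighborLabelSum (numNeighbors d β γ n i)).comp
      (f := fun p : CrowdSample d m n × EuclideanSpace ℝ (Fin d) => (p.1 i, p.2)) (by fun_prop)
  unfold vsnn
  refine measurable_to_bool ?_
  have : (fun p : CrowdSample d m n × EuclideanSpace ℝ (Fin d) =>
      decide (1 / 2 < vsnnRegression β γ n p.1 p.2)) ⁻¹' {true}
      = {p | 1 / 2 < vsnnRegression β γ n p.1 p.2} := by
    ext p; simp
  convert measurableSet_lt measurable_const h using 1

/-! ### Labels given the covariates -/

section Labels

variable {d : ℕ} {P : Measure (Obs d)} {η : EuclideanSpace ℝ (Fin d) → ℝ}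

open ENNReal in
theorem IsRegressionFunction.prob_false [IsProbabilityMeasure P] (h : IsRegressionFunction P η)
    {A : Set (EuclideanSpace ℝ (Fin d))} (hA : MeasurableSet A) :
    P (A ×ˢ {false}) = ∫⁻ x in A, ENNReal.ofReal (1 - η x) ∂P.fst := by
  have h1 : P (A ×ˢ {true}) + P (A ×ˢ {false}) = P.fst A := by
    rw [Measure.fst_apply hA, ← measure_union _ (hA.prod (measurableSet_singleton _))]
    · congr 1
      ext ⟨x, b⟩
      cases b <;> simp
    · rw [Set.disjoint_left]
      rintro ⟨x, b⟩ hb hb'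
      simp_all
  have h2 : ∫⁻ x in A, ENNReal.ofReal (η x) ∂P.fst + ∫⁻ x in A, ENNReal.ofReal (1 - η x) ∂P.fst
      = P.fst A := by
    rw [← lintegral_add_left h.measurable.ennreal_ofReal]
    have : ∀ x, ENNReal.ofReal (η x) + ENNReal.ofReal (1 - η x) = 1 := fun x => by
      rw [← ENNReal.ofReal_add (h.mem_unit x).1 (by linarith [(h.mem_unit x).2])]
      simp
    simp [this]
  rw [h.prob_true A hA] at h1
  have h3 : ∫⁻ x in A, ENNReal.ofReal (η x) ∂P.fst ≠ ∞ :=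
    ne_top_of_le_ne_top (measure_ne_top P.fst A) (h2 ▸ le_self_add)
  exact (ENNReal.add_right_inj h3).1 (h1.trans h2.symm)

/-- The label as a function of a uniform random variable. -/
noncomputable def thresholdLabel (η : EuclideanSpace ℝ (Fin d) → ℝ)
    (p : EuclideanSpace ℝ (Fin d) × ℝ) : Obs d :=
  (p.1, decide (p.2 < η p.1))

theorem measurable_thresholdLabel (hη : Measurable η) : Measurable (thresholdLabel η) := by
  refine measurable_fst.prodMk (measurable_to_bool ?_)
  have : (fun p : EuclideanSpace ℝ (Fin d) × ℝ => decide (p.2 < η p.1)) ⁻¹' {true}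
      = {p | p.2 < η p.1} := by
    ext p; simp
  rw [this]
  exact measurableSet_lt measurable_snd (hη.comp measurable_fst)

/-- The uniform law on the unit interval. -/
noncomputable def unitLaw : Measure ℝ := volume.restrict (Ico 0 1)

instance : IsProbabilityMeasure unitLaw := ⟨by simp [unitLaw]⟩

theorem unitLaw_Iio {u : ℝ} (hu : u ∈ Icc (0 : ℝ) 1) : unitLaw (Iio u) = ENNReal.ofReal u := by
  rw [unitLaw, Measure.restrict_apply measurableSet_Iio]
  have : Iio u ∩ Ico 0 1 = Ico 0 u := by
    ext v
    simp only [mem_inter_iff, mem_Iio, mem_Ico]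
    have := hu.2
    constructor
    · rintro ⟨h1, h2, h3⟩
      exact ⟨h2, h1⟩
    · rintro ⟨h1, h2⟩
      exact ⟨h2, h1, by linarith⟩
  rw [this, Real.volume_Ico, sub_zero]

theorem unitLaw_Ici {u : ℝ} (hu : u ∈ Icc (0 : ℝ) 1) :
    unitLaw (Ici u) = ENNReal.ofReal (1 - u) := by
  rw [← compl_Iio, prob_compl_eq_one_sub measurableSet_Iio, unitLaw_Iio hu,
    ENNReal.ofReal_sub _ hu.1, ENNReal.ofReal_one]

/-- Writing the label as `U < η X` with `U` uniform and independent of `X` makes conditioning on the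
covariates an application of Fubini. Sets `A ×ˢ {b}` suffice, since every measurable set is the
disjoint union of its two label slices. -/
theorem IsRegressionFunction.map_thresholdLabel [IsProbabilityMeasure P]
    (h : IsRegressionFunction P η) : (P.fst.prod unitLaw).map (thresholdLabel η) = P := by
  have hm := measurable_thresholdLabel h.measurable
  have : IsProbabilityMeasure ((P.fst.prod unitLaw).map (thresholdLabel η)) :=
    Measure.isProbabilityMeasure_map hm.aemeasurable
  have key : ∀ (A : Set (EuclideanSpace ℝ (Fin d))) (b : Bool), MeasurableSet A →
      (P.fst.prod unitLaw).map (thresholdLabel η) (A ×ˢ {b}) = P (A ×ˢ {b}) := by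
    intro A b hA
    have hAb : MeasurableSet (A ×ˢ {b} : Set (Obs d)) := hA.prod (measurableSet_singleton b)
    rw [Measure.map_apply hm hAb, Measure.prod_apply (hm hAb)]
    cases b
    · rw [h.prob_false hA, ← lintegral_indicator hA]
      refine lintegral_congr fun x => ?_
      by_cases hx : x ∈ A
      · have : Prod.mk x ⁻¹' (thresholdLabel η ⁻¹' A ×ˢ {false}) = Ici (η x) := by
          ext u; simp [thresholdLabel, hx]
        rw [this, unitLaw_Ici (h.mem_unit x), indicator_of_mem hx]
      · have : Prod.mk x ⁻¹' (thresholdLabel η ⁻¹' A ×ˢ {false}) = ∅ := by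
          ext u; simp [thresholdLabel, hx]
        rw [this, measure_empty, indicator_of_notMem hx]
    · rw [h.prob_true A hA, ← lintegral_indicator hA]
      refine lintegral_congr fun x => ?_
      by_cases hx : x ∈ A
      · have : Prod.mk x ⁻¹' (thresholdLabel η ⁻¹' A ×ˢ {true}) = Iio (η x) := by
          ext u; simp [thresholdLabel, hx]
        rw [this, unitLaw_Iio (h.mem_unit x), indicator_of_mem hx]
      · have : Prod.mk x ⁻¹' (thresholdLabel η ⁻¹' A ×ˢ {true}) = ∅ := by
          ext u; simp [thresholdLabel, hx]
        rw [this, measure_empty, indicator_of_notMem hx]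
  ext S hS
  have hslice : ∀ b : Bool, MeasurableSet ((fun x => (x, b)) ⁻¹' S :
      Set (EuclideanSpace ℝ (Fin d))) := fun b => measurable_prodMk_right hS
  have hSU : S = ((fun x => (x, true)) ⁻¹' S) ×ˢ {true} ∪ ((fun x => (x, false)) ⁻¹' S) ×ˢ {false} := by
    ext ⟨x, b⟩
    cases b <;> simp
  have hdisj : Disjoint (((fun x => (x, true)) ⁻¹' S) ×ˢ {true} : Set (Obs d))
      (((fun x => (x, false)) ⁻¹' S) ×ˢ {false}) := by
    rw [Set.disjoint_left]
    rintro ⟨x, b⟩ hb hb'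
    exact absurd (hb.2.symm.trans hb'.2) (by simp)
  rw [hSU, measure_union hdisj ((hslice _).prod (measurableSet_singleton _)),
    measure_union hdisj ((hslice _).prod (measurableSet_singleton _)), key _ _ (hslice _),
    key _ _ (hslice _)]

theorem lintegral_pi_prod_eq {ι : Type*} [Fintype ι] {Ω : ι → Type*}
    [∀ i, MeasurableSpace (Ω i)] (μ : ∀ i, Measure (Ω i)) [∀ i, IsProbabilityMeasure (μ i)]
    {f : ∀ i, Ω i → ENNReal} (hf : ∀ i, Measurable (f i)) :
    ∫⁻ x, ∏ i, f i (x i) ∂(Measure.pi μ) = ∏ i, ∫⁻ x, f i x ∂(μ i) := by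
  have hind : ProbabilityTheory.iIndepFun (fun i (x : ∀ i, Ω i) => f i (x i)) (Measure.pi μ) :=
    ProbabilityTheory.iIndepFun_pi fun i => (hf i).aemeasurable
  have := ProbabilityTheory.lintegral_prod_eq_prod_lintegral_of_indepFun Finset.univ
    (fun i (x : ∀ i, Ω i) => f i (x i)) hind fun i => (hf i).comp (measurable_pi_apply i)
  rw [this]
  refine Finset.prod_congr rfl fun i _ => ?_
  exact (measurePreserving_eval μ i).lintegral_comp (hf i)

/-- A product of functions of the single labels of an i.i.d. sample, which may depend on all the
covariates, is integrated by averaging each factor over its label. -/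
theorem IsRegressionFunction.lintegral_pi_prod [IsProbabilityMeasure P]
    (h : IsRegressionFunction P η) {ι : Type*} [Fintype ι]
    {F : ι → (ι → EuclideanSpace ℝ (Fin d)) → Bool → ENNReal}
    (hF : ∀ j b, Measurable fun X => F j X b) :
    ∫⁻ s, ∏ j, F j (fun l => (s l).1) (s j).2 ∂(Measure.pi fun _ : ι => P) =
      ∫⁻ X, ∏ j, (F j X true * ENNReal.ofReal (η (X j)) +
        F j X false * ENNReal.ofReal (1 - η (X j))) ∂(Measure.pi fun _ : ι => P.fst) := by
  have hm := measurable_thresholdLabel h.measurable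
  have hF' : ∀ j, Measurable fun s : ι → Obs d => F j (fun l => (s l).1) (s j).2 := by
    intro j
    have h1 : Measurable fun q : (ι → EuclideanSpace ℝ (Fin d)) × Bool => F j q.1 q.2 :=
      measurable_from_prod_countable_left fun b => hF j b
    exact h1.comp (f := fun s : ι → Obs d => ((fun l => (s l).1), (s j).2)) (by fun_prop)
  have hprob : ∀ _ : ι, IsProbabilityMeasure ((P.fst.prod unitLaw).map (thresholdLabel η)) :=
    fun _ => Measure.isProbabilityMeasure_map hm.aemeasurable
  have hmap : (Measure.pi fun _ : ι => P) =
      ((Measure.pi fun _ : ι => P.fst.prod unitLaw).map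
        fun q j => thresholdLabel η (q j)) := by
    rw [Measure.pi_map_pi fun _ => hm.aemeasurable]
    simp only [h.map_thresholdLabel]
  -- Regroups the array of pairs `(X, U)` into an array of covariates and an independent array of
  -- uniforms, so that the inner integral runs over the uniforms alone.
  have hmp := measurePreserving_arrowProdEquivProdArrow (EuclideanSpace ℝ (Fin d)) ℝ ι
    (fun _ => P.fst) (fun _ => unitLaw)
  have hprodm : Measurable fun s : ι → Obs d => ∏ j, F j (fun l => (s l).1) (s j).2 :=
    Finset.measurable_fun_prod _ fun j _ => hF' j
  have hth : Measurable fun (q : ι → EuclideanSpace ℝ (Fin d) × ℝ) j => thresholdLabel η (q j) :=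
    measurable_pi_lambda _ fun j => hm.comp (measurable_pi_apply j)
  rw [hmap, lintegral_map hprodm hth]
  refine (hmp.symm.lintegral_comp (hprodm.comp hth)).symm.trans ?_
  refine (lintegral_prod _
    ((hprodm.comp (hth.comp (MeasurableEquiv.measurable _))).aemeasurable)).trans ?_
  refine lintegral_congr fun X => ?_
  have hlab : ∀ j, Measurable fun u : ℝ => F j X (decide (u < η (X j))) := by
    intro j
    have : Measurable fun u : ℝ => decide (u < η (X j)) := by
      refine measurable_to_bool ?_
      convert measurableSet_Iio (a := η (X j)) using 1
      ext u; simp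
    exact (measurable_of_countable (F j X)).comp this
  refine (lintegral_pi_prod_eq (fun _ : ι => unitLaw) hlab).trans ?_
  refine Finset.prod_congr rfl fun j _ => ?_
  rw [← lintegral_add_compl _ (measurableSet_Iio (a := η (X j)))]
  congr 1
  · rw [setLIntegral_congr_fun (g := fun _ => F j X true) measurableSet_Iio
      (fun u hu => by simp [mem_Iio.1 hu]), setLIntegral_const, unitLaw_Iio (h.mem_unit _)]
  · rw [setLIntegral_congr_fun (g := fun _ => F j X false) measurableSet_Iio.compl
      (fun u hu => by
        have : ¬ u < η (X j) := by simpa using hu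
        simp [this]), setLIntegral_const, compl_Iio, unitLaw_Ici (h.mem_unit _)]

end Labels

/-! ### Exponential moments of the votes -/

section Votes

open Real in
/-- Hoeffding's lemma for a Bernoulli variable. -/
theorem bernoulli_exp_moment_le {u : ℝ} (hu : u ∈ Icc (0 : ℝ) 1) (a : ℝ) :
    exp (-(a * (1 - 1 / 2))) * u + exp (-(a * (0 - 1 / 2))) * (1 - u) ≤
      exp (-(a * (u - 1 / 2)) + a ^ 2 / 8) := by
  have h1u : 0 ≤ 1 - u := by linarith [hu.2]
  -- The two-point law on `{0, 1}` with mean `u`; its range of length `1` gives the variance proxy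
  -- `1/4`, hence `a ^ 2 / 8`.
  let μ : Measure ℝ := ENNReal.ofReal u • Measure.dirac 1 + ENNReal.ofReal (1 - u) • Measure.dirac 0
  have hμ : IsProbabilityMeasure μ := by
    constructor
    simp only [μ, Measure.add_apply, Measure.smul_apply, measure_univ, smul_eq_mul, mul_one]
    rw [← ENNReal.ofReal_add hu.1 h1u]
    simp
  have hint : ∀ f : ℝ → ℝ, ∫ y, f y ∂μ = f 1 * u + f 0 * (1 - u) := by
    intro f
    have hi : ∀ v : ℝ, Integrable f (Measure.dirac v) := fun v => integrable_dirac (by simp)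
    rw [integral_add_measure ((hi 1).smul_measure ENNReal.ofReal_ne_top)
      ((hi 0).smul_measure ENNReal.ofReal_ne_top), integral_smul_measure, integral_smul_measure]
    simp [ENNReal.toReal_ofReal hu.1, ENNReal.toReal_ofReal h1u, mul_comm]
  have hsub := ProbabilityTheory.hasSubgaussianMGF_of_mem_Icc (μ := μ) (X := fun y : ℝ => y)
    (a := 0) (b := 1) aemeasurable_id (by
      simp only [μ, ae_add_measure_iff]
      refine ⟨Measure.ae_smul_measure ?_ _, Measure.ae_smul_measure ?_ _⟩ <;>
        simp [ae_dirac_eq])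
  have h := hsub.mgf_le (-a)
  rw [ProbabilityTheory.mgf, hint] at h
  simp only [hint] at h
  -- Moves the centre from the mean `u` to `1/2`.
  have h2 : exp (-(a * (u - 1 / 2))) * (exp (-a * (1 - (1 * u + 0 * (1 - u)))) * u +
      exp (-a * (0 - (1 * u + 0 * (1 - u)))) * (1 - u)) ≤
      exp (-(a * (u - 1 / 2))) * exp (a ^ 2 / 8) := by
    refine mul_le_mul_of_nonneg_left (h.trans (le_of_eq ?_)) (exp_pos _).le
    congr 1
    simp
    ring
  rw [← Real.exp_add] at h2
  refine le_trans (le_of_eq ?_) h2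
  rw [mul_add, ← mul_assoc, ← mul_assoc, ← Real.exp_add, ← Real.exp_add]
  ring_nf

variable {d N : ℕ}

open Classical in
/-- The largest possible loss of signal from the neighbours at distance at least `r`. -/
noncomputable def farBias (η : EuclideanSpace ℝ (Fin d) → ℝ) (g r : ℝ) (k : ℕ)
    (s : Fin N → Obs d) (x : EuclideanSpace ℝ (Fin d)) : ℝ :=
  ∑ j, if distRank s x j < k ∧ r ≤ dist (s j).1 x then g + |η (s j).1 - 1 / 2| else 0

theorem neighborLabelSum_sub {k : ℕ} (hk : k ≤ N) (s : Fin N → Obs d)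
    (x : EuclideanSpace ℝ (Fin d)) :
    neighborLabelSum s k x - k / 2 =
      ∑ j, if distRank s x j < k then ((if (s j).2 = true then 1 else 0) - 1 / 2 : ℝ) else 0 := by
  have h : (k : ℝ) / 2 = ∑ j, if distRank s x j < k then (1 / 2 : ℝ) else 0 := by
    rw [← Finset.sum_filter, Finset.sum_const, card_distRank_lt s x hk, nsmul_eq_mul]
    ring
  rw [h, neighborLabelSum, ← Finset.sum_sub_distrib]
  refine Finset.sum_congr rfl fun j _ => ?_
  split_ifs <;> simp

theorem measurable_farBias {η : EuclideanSpace ℝ (Fin d) → ℝ} (hη : Measurable η) (g r : ℝ)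
    (k : ℕ) (x : EuclideanSpace ℝ (Fin d)) :
    Measurable fun s : Fin N → Obs d => farBias η g r k s x := by
  unfold farBias
  refine Finset.measurable_sum _ fun j _ => Measurable.ite ?_ ?_ measurable_const
  · exact (measurableSet_lt ((measurable_distRank j).comp
      (f := fun s : Fin N → Obs d => (s, x)) (by fun_prop)) measurable_const).inter
      (measurableSet_le (f := fun _ => r) (g := fun s : Fin N → Obs d => dist (s j).1 x)
        measurable_const (by fun_prop))
  · have : Measurable fun s : Fin N → Obs d => η (s j).1 := 
      hη.comp (f := fun s : Fin N → Obs d => (s j).1) (by fun_prop)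
    exact measurable_const.add (this.sub_const _).abs

/-- The votes of the `k` nearest neighbours, with the loss of signal of the far neighbours added
back, have an exponential moment of sub-Gaussian type. -/
theorem IsRegressionFunction.lintegral_exp_votes_le {P : Measure (Obs d)} [IsProbabilityMeasure P]
    {η : EuclideanSpace ℝ (Fin d) → ℝ} (h : IsRegressionFunction P η) {k : ℕ} (hk : k ≤ N)
    (x : EuclideanSpace ℝ (Fin d)) {a : ℝ} (ha : 0 ≤ a) {σ : ℝ} (hσ : |σ| = 1) {g r : ℝ}
    (hg : ∀ᵐ y ∂P.fst, dist y x < r → g ≤ σ * (η y - 1 / 2)) :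
    ∫⁻ s, ENNReal.ofReal (Real.exp
        (-(a * (σ * (neighborLabelSum s k x - k / 2) + farBias η g r k s x))))
        ∂(Measure.pi fun _ : Fin N => P) ≤
      ENNReal.ofReal (Real.exp (-(a * (k * g)) + a ^ 2 * k / 8)) := by
  classical
  let far : EuclideanSpace ℝ (Fin d) → ℝ := fun y => if r ≤ dist y x then g + |η y - 1 / 2| else 0
  -- The label `true` is a dummy: ranks depend on the covariates only.
  let R : (Fin N → EuclideanSpace ℝ (Fin d)) → Fin N → ℕ :=
    fun X j => distRank (fun l => (X l, true)) x j
  let F : Fin N → (Fin N → EuclideanSpace ℝ (Fin d)) → Bool → ENNReal := fun j X b =>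
    ENNReal.ofReal (Real.exp (if R X j < k then
      -(a * (σ * ((if b = true then 1 else 0) - 1 / 2) + far (X j))) else 0))
  have hR : ∀ j, Measurable fun X => R X j := fun j =>
    (measurable_distRank j).comp (f := fun X : Fin N → EuclideanSpace ℝ (Fin d) =>
      ((fun l => (X l, true)), x)) (by fun_prop)
  have hfar : Measurable far := by
    refine Measurable.ite (measurableSet_le measurable_const (by fun_prop)) ?_ measurable_const
    exact measurable_const.add (h.measurable.sub_const _).abs
  have hF : ∀ j b, Measurable fun X => F j X b := by
    intro j b
    refine (Real.measurable_exp.comp ?_).ennreal_ofReal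
    refine Measurable.ite (measurableSet_lt (hR j) measurable_const) ?_ measurable_const
    exact ((measurable_const.add (hfar.comp (measurable_pi_apply j))).const_mul _).neg
  have hprod : ∀ s : Fin N → Obs d, ENNReal.ofReal (Real.exp
      (-(a * (σ * (neighborLabelSum s k x - k / 2) + farBias η g r k s x)))) =
      ∏ j, F j (fun l => (s l).1) (s j).2 := by
    intro s
    simp only [F]
    rw [← ENNReal.ofReal_prod_of_nonneg (fun _ _ => (Real.exp_pos _).le), ← Real.exp_sum]
    congr 2
    rw [neighborLabelSum_sub hk, farBias, Finset.mul_sum, ← Finset.sum_add_distrib,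
      Finset.mul_sum, ← Finset.sum_neg_distrib]
    refine Finset.sum_congr rfl fun j _ => ?_
    have hRj : R (fun l => (s l).1) j = distRank s x j := distRank_congr (fun _ => rfl) x j
    simp only [hRj, far]
    by_cases h1 : distRank s x j < k <;> by_cases h2 : r ≤ dist (s j).1 x <;> simp [h1, h2]
  simp_rw [hprod]
  rw [h.lintegral_pi_prod hF]
  have hae : ∀ᵐ X ∂(Measure.pi fun _ : Fin N => P.fst), ∀ j,
      dist (X j) x < r → g ≤ σ * (η (X j) - 1 / 2) := by
    rw [ae_all_iff]
    intro j
    exact (measurePreserving_eval (fun _ : Fin N => P.fst) j).quasiMeasurePreserving.ae hg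
  calc _ ≤ ∫⁻ _, ENNReal.ofReal (Real.exp (-(a * (k * g)) + a ^ 2 * k / 8))
        ∂(Measure.pi fun _ : Fin N => P.fst) := by
        refine lintegral_mono_ae (hae.mono fun X hX => ?_)
        calc _ ≤ ∏ j, ENNReal.ofReal (Real.exp (if R X j < k then -(a * g) + a ^ 2 / 8 else 0)) := by
              refine Finset.prod_le_prod' fun j _ => ?_
              have hu := h.mem_unit (X j)
              simp only [F]
              rw [← ENNReal.ofReal_mul (Real.exp_pos _).le, ← ENNReal.ofReal_mul (Real.exp_pos _).le,
                ← ENNReal.ofReal_add (mul_nonneg (Real.exp_pos _).le hu.1)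
                  (mul_nonneg (Real.exp_pos _).le (by linarith [hu.2]))]
              apply ENNReal.ofReal_le_ofReal
              by_cases hj : R X j < k
              · simp only [hj, if_true, Bool.false_eq_true, if_false]
                have hm := bernoulli_exp_moment_le hu (a * σ)
                have hs : (a * σ) ^ 2 = a ^ 2 := by rw [mul_pow, ← sq_abs σ, hσ]; ring
                rw [hs] at hm
                -- A far point has signal at least `-|η - 1/2|`, so adding `g + |η - 1/2|` restores
                -- the signal `g`.
                have hfg : g ≤ σ * (η (X j) - 1 / 2) + far (X j) := by
                  simp only [far]
                  split_ifs with hfj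
                  · have : |σ * (η (X j) - 1 / 2)| = |η (X j) - 1 / 2| := by
                      rw [abs_mul, hσ, one_mul]
                    linarith [neg_abs_le (σ * (η (X j) - 1 / 2))]
                  · rw [add_zero]
                    exact hX j (not_le.1 hfj)
                calc _ = Real.exp (-(a * far (X j))) * (Real.exp (-(a * σ * (1 - 1 / 2))) * η (X j) +
                      Real.exp (-(a * σ * (0 - 1 / 2))) * (1 - η (X j))) := by
                      rw [mul_add (Real.exp _), ← mul_assoc, ← mul_assoc, ← Real.exp_add,
                        ← Real.exp_add]
                      ring_nf
                  _ ≤ Real.exp (-(a * far (X j))) *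
                      Real.exp (-(a * σ * (η (X j) - 1 / 2)) + a ^ 2 / 8) :=
                      mul_le_mul_of_nonneg_left hm (Real.exp_pos _).le
                  _ ≤ _ := by
                      rw [← Real.exp_add]
                      apply Real.exp_le_exp.2
                      nlinarith [mul_le_mul_of_nonneg_left hfg ha]
              · simp [hj]
          _ = _ := by
              rw [← ENNReal.ofReal_prod_of_nonneg (fun _ _ => (Real.exp_pos _).le), ← Real.exp_sum,
                ← Finset.sum_filter, Finset.sum_const, card_distRank_lt _ x hk, nsmul_eq_mul]
              ring_nf
    _ = _ := by simp

end Votes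

/-! ### Far neighbours are rare -/

section Far

variable {d N : ℕ}

/-- The event that less than `k` of the sample points are in the ball `B(x, r)`. -/
def fewNear (N k : ℕ) (x : EuclideanSpace ℝ (Fin d)) (r : ℝ) : Set (Fin N → Obs d) :=
  {s | (Finset.univ.filter fun l => dist (s l).1 x < r).card < k}

theorem measurableSet_fewNear (k : ℕ) (x : EuclideanSpace ℝ (Fin d)) (r : ℝ) :
    MeasurableSet (fewNear N k x r) := by
  classical
  refine measurableSet_lt ?_ measurable_const
  simp only [Finset.card_filter]
  refine Finset.measurable_sum _ fun j _ => Measurable.ite ?_ measurable_const measurable_const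
  exact measurableSet_lt (f := fun s : Fin N → Obs d => dist (s j).1 x) (g := fun _ => r)
    (by fun_prop) measurable_const

/-- A Chernoff bound for the number of sample points in a ball. -/
theorem measure_fewNear_le (P : Measure (Obs d)) [IsProbabilityMeasure P] {k : ℕ}
    (x : EuclideanSpace ℝ (Fin d)) (r : ℝ) {q : ℝ}
    (hball : ENNReal.ofReal q ≤ P.fst (Metric.ball x r)) (hk : 4 * k ≤ N * q) :
    (Measure.pi fun _ : Fin N => P) (fewNear N k x r) ≤
      ENNReal.ofReal (Real.exp (-(N * q / 4))) := by
  classical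
  let B : Set (Obs d) := Prod.fst ⁻¹' Metric.ball x r
  have hB : MeasurableSet B := measurable_fst Metric.isOpen_ball.measurableSet
  have hPB : P.real B = P.fst.real (Metric.ball x r) := by
    rw [measureReal_def, measureReal_def, Measure.fst_apply Metric.isOpen_ball.measurableSet]
  have hqB : q ≤ P.real B := by
    rw [hPB, measureReal_def]
    exact (ENNReal.ofReal_le_iff_le_toReal (measure_ne_top _ _)).1 hball
  -- Each point in the ball halves the product, so fewer than `k` of them leave it at least `2 ^
  -- (-k)`; Markov's inequality is applied to this product.
  let f : Obs d → ENNReal := fun z => ENNReal.ofReal (if z ∈ B then 1 / 2 else 1)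
  have hf : Measurable f :=
    (Measurable.ite hB measurable_const measurable_const).ennreal_ofReal
  have hfi : ∫⁻ z, f z ∂P ≤ ENNReal.ofReal (Real.exp (-(q / 2))) := by
    have h1 : ∫⁻ z, f z ∂P = ENNReal.ofReal (1 / 2) * P B + P Bᶜ := by
      rw [← lintegral_add_compl _ hB,
        setLIntegral_congr_fun (g := fun _ => ENNReal.ofReal (1 / 2)) hB
          (fun z hz => by simp only [f]; rw [if_pos hz]),
        setLIntegral_congr_fun (g := fun _ => 1) hB.compl
          (fun z hz => by simp only [f]; rw [if_neg hz, ENNReal.ofReal_one]), setLIntegral_const,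
        setLIntegral_const, one_mul]
    rw [h1, ← ofReal_measureReal (s := B), ← ofReal_measureReal (s := Bᶜ),
      probReal_compl_eq_one_sub hB, ← ENNReal.ofReal_mul (by norm_num),
      ← ENNReal.ofReal_add (mul_nonneg (by norm_num) measureReal_nonneg)
        (by linarith [measureReal_le_one (μ := P) (s := B)])]
    apply ENNReal.ofReal_le_ofReal
    have := Real.add_one_le_exp (-(q / 2))
    linarith
  have hmark : ∀ s ∈ fewNear N k x r, 1 ≤ 2 ^ k * ∏ j, f (s j) := by
    intro s hs
    have h1 : ∏ j, f (s j) =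
        ENNReal.ofReal ((1 / 2) ^ (Finset.univ.filter fun l => dist (s l).1 x < r).card) := by
      simp only [f]
      rw [← ENNReal.ofReal_prod_of_nonneg (fun _ _ => by split_ifs <;> norm_num), Finset.prod_ite,
        Finset.prod_const, Finset.prod_const_one, mul_one]
      rfl
    have h2 : (2 : ENNReal) ^ k = ENNReal.ofReal (2 ^ k) := by
      rw [ENNReal.ofReal_pow (by norm_num)]
      norm_num
    rw [h1, h2, ← ENNReal.ofReal_mul (by positivity), ENNReal.one_le_ofReal]
    calc (1 : ℝ) = 2 ^ k * (1 / 2) ^ k := by rw [← mul_pow]; norm_num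
      _ ≤ _ := by
        refine mul_le_mul_of_nonneg_left ?_ (by positivity)
        exact pow_le_pow_of_le_one (by norm_num) (by norm_num) (le_of_lt hs)
  calc _ = ∫⁻ s in fewNear N k x r, 1 ∂(Measure.pi fun _ : Fin N => P) := by simp
    _ ≤ ∫⁻ s in fewNear N k x r, 2 ^ k * ∏ j, f (s j) ∂(Measure.pi fun _ : Fin N => P) :=
        setLIntegral_mono' (measurableSet_fewNear k x r) hmark
    _ ≤ ∫⁻ s, 2 ^ k * ∏ j, f (s j) ∂(Measure.pi fun _ : Fin N => P) := setLIntegral_le_lintegral _ _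
    _ = 2 ^ k * (∫⁻ z, f z ∂P) ^ N := by
        have hm : Measurable fun s : Fin N → Obs d => ∏ j, f (s j) :=
          Finset.measurable_fun_prod _ fun j _ => hf.comp (measurable_pi_apply j)
        rw [lintegral_const_mul _ hm,
          lintegral_pi_prod_eq (fun _ : Fin N => P) (fun _ => hf), Finset.prod_const,
          Finset.card_univ, Fintype.card_fin]
    -- With `2 ≤ e` the exponent becomes `k - N q / 2`, and `4 k ≤ N q` leaves `-N q / 4`.
    _ ≤ ENNReal.ofReal (Real.exp 1) ^ k * ENNReal.ofReal (Real.exp (-(q / 2))) ^ N := by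
        gcongr
        rw [← ENNReal.ofReal_ofNat]
        apply ENNReal.ofReal_le_ofReal
        have := Real.add_one_le_exp 1
        linarith
    _ ≤ _ := by
        rw [← ENNReal.ofReal_pow (Real.exp_pos _).le, ← ENNReal.ofReal_pow (Real.exp_pos _).le,
          ← Real.exp_nat_mul, ← Real.exp_nat_mul, ← ENNReal.ofReal_mul (Real.exp_pos _).le,
          ← Real.exp_add]
        apply ENNReal.ofReal_le_ofReal
        apply Real.exp_le_exp.2
        linarith

theorem mem_fewNear_of_distRank_lt {s : Fin N → Obs d} {x : EuclideanSpace ℝ (Fin d)} {k : ℕ}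
    {j : Fin N} {r : ℝ} (hj : distRank s x j < k) (hr : r ≤ dist (s j).1 x) :
    s ∈ fewNear N k x r :=
  card_dist_lt_of_distRank_lt s x hj hr

/-- The bias of the far neighbours is bounded through a sequence of radii: if every sample point at
distance at least `r` is at distance at least `R l` and has bias at most `c l`, for some `l`, then
the bias per neighbour is at most the sum of those `c l` for which the nearest neighbours reach out
of the ball of radius `R l`. -/
theorem ofReal_farBias_le {η : EuclideanSpace ℝ (Fin d) → ℝ} {g r : ℝ} (hg : 0 ≤ g) {k : ℕ}
    (hk : k ≤ N) {s : Fin N → Obs d} {x : EuclideanSpace ℝ (Fin d)} {c : ℕ → ENNReal} {R : ℕ → ℝ}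
    (h : ∀ j, r ≤ dist (s j).1 x → ∃ l, R l ≤ dist (s j).1 x ∧
      ENNReal.ofReal (g + |η (s j).1 - 1 / 2|) ≤ c l) :
    ENNReal.ofReal (farBias η g r k s x) ≤
      k * ∑' l, (fewNear N k x (R l)).indicator (fun _ => c l) s := by
  classical
  unfold farBias
  rw [ENNReal.ofReal_sum_of_nonneg (fun j _ => by split_ifs <;> positivity)]
  calc _ ≤ ∑ j, if distRank s x j < k then
          ∑' l, (fewNear N k x (R l)).indicator (fun _ => c l) s else 0 := by
        refine Finset.sum_le_sum fun j _ => ?_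
        by_cases hj : distRank s x j < k
        · by_cases hr : r ≤ dist (s j).1 x
          · obtain ⟨l, hl, hc⟩ := h j hr
            rw [if_pos ⟨hj, hr⟩, if_pos hj]
            refine hc.trans (le_trans (le_of_eq ?_) (ENNReal.le_tsum l))
            rw [indicator_of_mem (mem_fewNear_of_distRank_lt hj hl)]
          · simp [hr]
        · simp [hj]
    _ = _ := by
        rw [← Finset.sum_filter, Finset.sum_const, card_distRank_lt s x hk, nsmul_eq_mul]

/-- The mass of a ball under a law with a density bounded below on its support. -/
theorem measure_ball_ge {μ : Measure (EuclideanSpace ℝ (Fin d))} [IsFiniteMeasure μ]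
    {Ω : Set (EuclideanSpace ℝ (Fin d))} {lo c r : ℝ} (hlo : 0 ≤ lo)
    (hc : 0 ≤ c) (hr : 0 < r)
    {x : EuclideanSpace ℝ (Fin d)}
    (hreg : ENNReal.ofReal c * volume (Metric.ball x r) ≤ volume (Ω ∩ Metric.ball x r))
    (hdens : ∀ᵐ y ∂(volume.restrict Ω), ENNReal.ofReal lo < μ.rnDeriv volume y) :
    ENNReal.ofReal (lo * c * (volume : Measure (EuclideanSpace ℝ (Fin d))).real (Metric.ball 0 1) *
      r ^ d) ≤ μ (Metric.ball x r) := by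
  calc _ = ENNReal.ofReal lo * (ENNReal.ofReal c * volume (Metric.ball x r)) := by
        rw [Measure.addHaar_ball_of_pos _ _ hr, finrank_euclideanSpace, Fintype.card_fin,
          ENNReal.ofReal_mul (by positivity), ENNReal.ofReal_mul (by positivity),
          ENNReal.ofReal_mul hlo, ofReal_measureReal (measure_ball_lt_top.ne)]
        ring
    _ ≤ ENNReal.ofReal lo * volume (Ω ∩ Metric.ball x r) := by gcongr
    _ = ∫⁻ _ in Ω ∩ Metric.ball x r, ENNReal.ofReal lo := by rw [setLIntegral_const]
    _ ≤ ∫⁻ y in Ω ∩ Metric.ball x r, μ.rnDeriv volume y := by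
        refine lintegral_mono_ae ?_
        have := ae_restrict_of_ae_restrict_of_subset (inter_subset_left (t := Metric.ball x r)) hdens
        exact this.mono fun y hy => hy.le
    _ ≤ μ (Ω ∩ Metric.ball x r) := Measure.setLIntegral_rnDeriv_le _
    _ ≤ _ := measure_mono inter_subset_right

end Far

/-! ### The probability of a wrong vote -/

section Vote

/-- An exponential tail is below every power. -/
theorem exists_mul_exp_neg_le {c e K : ℝ} (hc : 0 < c) (he : 0 < e) :
    ∃ D : ℝ, 0 < D ∧ ∀ ρ : ℝ, 1 ≤ ρ → ∀ k : ℕ, 0 < k →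
      k * Real.exp (-(c * k * ρ ^ e)) ≤ D * ρ ^ (-K) := by
  -- The `n`-th Taylor term of the exponential grows like `ρ ^ (e n)`, which dominates `ρ ^ K`.
  obtain ⟨n, hn⟩ := exists_nat_ge (K / e)
  have hK : K ≤ e * n := by
    rw [div_le_iff₀ he] at hn
    linarith
  refine ⟨2 / c * (n.factorial / (c / 2) ^ n), by positivity, fun ρ hρ k hk => ?_⟩
  have hρ0 : 0 < ρ := by linarith
  have hk1 : (1 : ℝ) ≤ k := by exact_mod_cast hk
  have hρe : 1 ≤ ρ ^ e := Real.one_le_rpow hρ he.le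
  set y := c / 2 * ρ ^ e with hy
  have hy0 : 0 < y := by positivity
  have h1 : (k : ℝ) * Real.exp (-(c / 2 * k)) ≤ 2 / c := by
    have := Real.add_one_le_exp (c / 2 * k)
    rw [Real.exp_neg, ← div_eq_mul_inv, div_le_div_iff₀ (Real.exp_pos _) hc]
    nlinarith
  have h2 : Real.exp (-y) ≤ n.factorial / (c / 2) ^ n * ρ ^ (-K) := by
    have h3 := Real.pow_div_factorial_le_exp y hy0.le n
    have h4 : ρ ^ K ≤ (ρ ^ e) ^ n := by
      rw [← Real.rpow_natCast, ← Real.rpow_mul hρ0.le]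
      exact Real.rpow_le_rpow_of_exponent_le hρ hK
    rw [Real.exp_neg, Real.rpow_neg hρ0.le, ← div_eq_mul_inv, div_div, inv_eq_one_div,
      div_le_div_iff₀ (Real.exp_pos _) (by positivity)]
    rw [div_le_iff₀ (by positivity), hy, mul_pow] at h3
    have h5 := mul_le_mul_of_nonneg_left h4 (show (0 : ℝ) ≤ (c / 2) ^ n by positivity)
    linarith
  -- Half of the exponent absorbs the factor `k`, the other half gives the power decay, so `D` does
  -- not depend on `k`.
  calc k * Real.exp (-(c * k * ρ ^ e))
      ≤ k * (Real.exp (-(c / 2 * k)) * Real.exp (-y)) := by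
        rw [← Real.exp_add]
        refine mul_le_mul_of_nonneg_left (Real.exp_le_exp.2 ?_) (by positivity)
        have h6 : (k : ℝ) ≤ k * ρ ^ e := le_mul_of_one_le_right (by positivity) hρe
        have h7 : ρ ^ e ≤ k * ρ ^ e := le_mul_of_one_le_left (by positivity) hk1
        rw [hy]
        nlinarith
    _ = k * Real.exp (-(c / 2 * k)) * Real.exp (-y) := by ring
    _ ≤ 2 / c * (n.factorial / (c / 2) ^ n * ρ ^ (-K)) :=
        mul_le_mul h1 h2 (Real.exp_pos _).le (by positivity)
    _ = _ := by ring

variable {d m : ℕ}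

instance {n : Fin (m + 1) → ℕ} {P : Fin (m + 1) → Measure (Obs d)}
    [∀ i, IsProbabilityMeasure (P i)] : IsProbabilityMeasure (crowdLaw n P) := by
  unfold crowdLaw; infer_instance

/-- The probability of a wrong weighted vote, in terms of the signal `G` of near neighbours, the
variance `V` of the vote, and the expected bias of far neighbours. -/
theorem crowdLaw_vote_le {n : Fin (m + 1) → ℕ} {P : Fin (m + 1) → Measure (Obs d)}
    [∀ i, IsProbabilityMeasure (P i)] {η : Fin (m + 1) → EuclideanSpace ℝ (Fin d) → ℝ}
    (h : ∀ i, IsRegressionFunction (P i) (η i)) {k : Fin (m + 1) → ℕ} (hk : ∀ i, k i ≤ n i)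
    {w g : Fin (m + 1) → ℝ} (hw : ∀ i, 0 ≤ w i) (hg : ∀ i, 0 ≤ g i) (x : EuclideanSpace ℝ (Fin d))
    {σ r : ℝ} (hσ : |σ| = 1)
    (hsig : ∀ i, ∀ᵐ y ∂(P i).fst, dist y x < r → g i ≤ σ * (η i y - 1 / 2))
    {G V : ℝ} (hG : 0 < G) (hV : 0 < V) (hGe : ∑ i, w i * (k i * g i) = G)
    (hVe : ∑ i, (k i : ℝ) * w i ^ 2 = V) :
    crowdLaw n P {s | ∑ i, w i * (σ * (neighborLabelSum (s i) (k i) x - k i / 2)) ≤ 0} ≤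
      ENNReal.ofReal (Real.exp (-(G ^ 2 / (2 * V)))) + ENNReal.ofReal (2 / G) *
        ∑ i, ENNReal.ofReal (w i) * ∫⁻ s, ENNReal.ofReal (farBias (η i) (g i) r (k i) s x)
          ∂(Measure.pi fun _ : Fin (n i) => P i) := by
  classical
  -- The minimiser of the Chernoff exponent `-L G / 2 + L ^ 2 V / 8`.
  let L : ℝ := 2 * G / V
  have hL : 0 ≤ L := by positivity
  let B : ∀ i, (Fin (n i) → Obs d) → ℝ := fun i s => farBias (η i) (g i) r (k i) s x
  let T : ∀ i, (Fin (n i) → Obs d) → ℝ := fun i s =>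
    σ * (neighborLabelSum s (k i) x - k i / 2) + B i s
  have hB0 : ∀ i s, 0 ≤ B i s := fun i s =>
    Finset.sum_nonneg fun j _ => by have := hg i; split_ifs <;> positivity
  have hBm : ∀ i, Measurable (B i) := fun i => measurable_farBias (h i).measurable _ _ _ _
  have hTm : ∀ i, Measurable (T i) := by
    intro i
    have : Measurable fun s : Fin (n i) → Obs d => neighborLabelSum s (k i) x :=
      (measurable_neighborLabelSum (k i)).comp (f := fun s : Fin (n i) → Obs d => (s, x))
        (by fun_prop)
    exact ((this.sub_const _).const_mul _).add (hBm i)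
  let f : CrowdSample d m n → ENNReal := fun s =>
    ENNReal.ofReal (Real.exp (L * (G / 2))) * ∏ i, ENNReal.ofReal (Real.exp (-(L * w i * T i (s i))))
  let b : CrowdSample d m n → ENNReal := fun s =>
    ENNReal.ofReal (2 / G) * ∑ i, ENNReal.ofReal (w i) * ENNReal.ofReal (B i (s i))
  have hfm : ∀ i, Measurable fun s => ENNReal.ofReal (Real.exp (-(L * w i * T i s))) := fun i =>
    (Real.measurable_exp.comp ((hTm i).const_mul _).neg).ennreal_ofReal
  have hprodm : Measurable fun s : CrowdSample d m n =>
      ∏ i, ENNReal.ofReal (Real.exp (-(L * w i * T i (s i)))) :=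
    Finset.measurable_fun_prod _ fun i _ => (hfm i).comp (measurable_pi_apply i)
  have hbm : ∀ i, Measurable fun s : CrowdSample d m n => ENNReal.ofReal (B i (s i)) := fun i =>
    ((hBm i).comp (measurable_pi_apply i)).ennreal_ofReal
  have hpt : ∀ s ∈ {s : CrowdSample d m n |
      ∑ i, w i * (σ * (neighborLabelSum (s i) (k i) x - k i / 2)) ≤ 0}, 1 ≤ f s + b s := by
    intro s hs
    rw [mem_ofPred_eq] at hs
    -- If the far bias is at most `G / 2`, the corrected vote, whose exponential moment corresponds
    -- to signal `G`, is at most `G / 2`, and `f ≥ 1`. Otherwise `b ≥ 1` as in Markov's inequality.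
    -- Only the sum of the biases matters, so the number of sources does not enter.
    by_cases hb : ∑ i, w i * B i (s i) ≤ G / 2
    · refine le_trans ?_ le_self_add
      simp only [f]
      rw [← ENNReal.ofReal_prod_of_nonneg (fun _ _ => (Real.exp_pos _).le), ← Real.exp_sum,
        ← ENNReal.ofReal_mul (Real.exp_pos _).le, ← Real.exp_add, ENNReal.one_le_ofReal,
        Real.one_le_exp_iff, Finset.sum_neg_distrib]
      have h1 : ∑ i, L * w i * T i (s i) = L * (∑ i, w i * (σ *
          (neighborLabelSum (s i) (k i) x - k i / 2)) + ∑ i, w i * B i (s i)) := by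
        rw [← Finset.sum_add_distrib, Finset.mul_sum]
        exact Finset.sum_congr rfl fun i _ => by simp only [T]; ring
      rw [h1, ← sub_eq_add_neg, sub_nonneg]
      exact mul_le_mul_of_nonneg_left (by linarith) hL
    · refine le_trans ?_ le_add_self
      simp only [b]
      simp_rw [← ENNReal.ofReal_mul (hw _)]
      rw [← ENNReal.ofReal_sum_of_nonneg (fun i _ => mul_nonneg (hw i) (hB0 i _)),
        ← ENNReal.ofReal_mul (by positivity), ENNReal.one_le_ofReal, div_mul_eq_mul_div,
        le_div_iff₀ hG]
      linarith
  have hf : ∫⁻ s, f s ∂(crowdLaw n P) ≤ ENNReal.ofReal (Real.exp (-(G ^ 2 / (2 * V)))) := by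
    calc _ = ENNReal.ofReal (Real.exp (L * (G / 2))) *
          ∏ i, ∫⁻ s, ENNReal.ofReal (Real.exp (-(L * w i * T i s)))
            ∂(Measure.pi fun _ : Fin (n i) => P i) := by
          simp only [f]
          rw [lintegral_const_mul _ hprodm, crowdLaw, lintegral_pi_prod_eq _ hfm]
      _ ≤ ENNReal.ofReal (Real.exp (L * (G / 2))) * ∏ i, ENNReal.ofReal
            (Real.exp (-(L * w i * (k i * g i)) + (L * w i) ^ 2 * k i / 8)) := by
          gcongr with i
          exact (h i).lintegral_exp_votes_le (hk i) x (mul_nonneg hL (hw i)) hσ (hsig i)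
      _ = ENNReal.ofReal (Real.exp (L * (G / 2) + (-(L * G) + L ^ 2 * V / 8))) := by
          rw [← ENNReal.ofReal_prod_of_nonneg (fun _ _ => (Real.exp_pos _).le), ← Real.exp_sum,
            ← ENNReal.ofReal_mul (Real.exp_pos _).le, ← Real.exp_add, Finset.sum_add_distrib,
            ← hGe, ← hVe]
          congr 4
          · rw [Finset.mul_sum, ← Finset.sum_neg_distrib]
            exact Finset.sum_congr rfl fun i _ => by ring
          · rw [Finset.mul_sum, Finset.sum_div]
            exact Finset.sum_congr rfl fun i _ => by ring
      _ = _ := by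
          congr 2
          simp only [L]
          field_simp
          ring
  have hbint : ∫⁻ s, b s ∂(crowdLaw n P) = ENNReal.ofReal (2 / G) *
      ∑ i, ENNReal.ofReal (w i) * ∫⁻ s, ENNReal.ofReal (B i s)
        ∂(Measure.pi fun _ : Fin (n i) => P i) := by
    simp only [b]
    rw [lintegral_const_mul _ (Finset.measurable_sum _ fun i _ => (hbm i).const_mul _),
      lintegral_finsetSum _ fun i _ => (hbm i).const_mul _]
    congr 1
    refine Finset.sum_congr rfl fun i _ => ?_
    rw [lintegral_const_mul _ (hbm i)]
    congr 1
    exact (measurePreserving_eval (fun i => Measure.pi fun _ : Fin (n i) => P i) i).lintegral_comp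
      (hBm i).ennreal_ofReal
  have hSm : MeasurableSet {s : CrowdSample d m n |
      ∑ i, w i * (σ * (neighborLabelSum (s i) (k i) x - k i / 2)) ≤ 0} := by
    refine measurableSet_le (Finset.measurable_sum _ fun i _ => ?_) measurable_const
    have : Measurable fun s : CrowdSample d m n => neighborLabelSum (s i) (k i) x :=
      (measurable_neighborLabelSum (k i)).comp (f := fun s : CrowdSample d m n => (s i, x))
        (by fun_prop)
    exact ((this.sub_const _).const_mul _).const_mul _
  calc _ = ∫⁻ _ in {s : CrowdSample d m n |
          ∑ i, w i * (σ * (neighborLabelSum (s i) (k i) x - k i / 2)) ≤ 0}, 1 ∂(crowdLaw n P) := by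
        simp
    _ ≤ ∫⁻ s in {s : CrowdSample d m n |
          ∑ i, w i * (σ * (neighborLabelSum (s i) (k i) x - k i / 2)) ≤ 0}, f s + b s
          ∂(crowdLaw n P) := setLIntegral_mono' hSm hpt
    _ ≤ ∫⁻ s, f s + b s ∂(crowdLaw n P) := setLIntegral_le_lintegral _ _
    _ = ∫⁻ s, f s ∂(crowdLaw n P) + ∫⁻ s, b s ∂(crowdLaw n P) :=
        lintegral_add_left (hprodm.const_mul _) _
    _ ≤ _ := by
        rw [hbint]
        gcongr

end Vote

/-! ### The expected bias of far neighbours -/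

section Bias

variable {d N : ℕ} {P : Measure (Obs d)} [IsProbabilityMeasure P]

theorem lintegral_farBias_le {η : EuclideanSpace ℝ (Fin d) → ℝ} {g r : ℝ} (hg : 0 ≤ g) {k : ℕ}
    (hk : k ≤ N) {x : EuclideanSpace ℝ (Fin d)} {c : ℕ → ENNReal} {R : ℕ → ℝ}
    (h : ∀ᵐ y ∂P.fst, r ≤ dist y x → ∃ l, R l ≤ dist y x ∧
      ENNReal.ofReal (g + |η y - 1 / 2|) ≤ c l) :
    ∫⁻ s, ENNReal.ofReal (farBias η g r k s x) ∂(Measure.pi fun _ : Fin N => P) ≤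
      ∑' l, c l * (k * (Measure.pi fun _ : Fin N => P) (fewNear N k x (R l))) := by
  have hP : ∀ᵐ z ∂P, r ≤ dist z.1 x → ∃ l, R l ≤ dist z.1 x ∧
      ENNReal.ofReal (g + |η z.1 - 1 / 2|) ≤ c l :=
    ae_of_ae_map measurable_fst.aemeasurable h
  have hae : ∀ᵐ s ∂(Measure.pi fun _ : Fin N => P), ∀ j, r ≤ dist (s j).1 x →
      ∃ l, R l ≤ dist (s j).1 x ∧ ENNReal.ofReal (g + |η (s j).1 - 1 / 2|) ≤ c l := by
    rw [ae_all_iff]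
    intro j
    exact (measurePreserving_eval (fun _ : Fin N => P) j).quasiMeasurePreserving.ae hP
  have hm : ∀ l, Measurable ((fewNear N k x (R l)).indicator fun _ => c l) := fun l =>
    measurable_const.indicator (measurableSet_fewNear k x (R l))
  refine (lintegral_mono_ae (hae.mono fun s hs => ofReal_farBias_le hg hk hs)).trans ?_
  rw [lintegral_const_mul _ (Measurable.tsum hm), lintegral_tsum fun l => (hm l).aemeasurable,
    ← ENNReal.tsum_mul_left]
  refine le_of_eq (tsum_congr fun l => ?_)
  rw [lintegral_indicator_const (measurableSet_fewNear k x (R l))]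
  ring

variable {x : EuclideanSpace ℝ (Fin d)} {k : ℕ} {c e κ β δ K D : ℝ}

/-- The probability that the `k` nearest neighbours reach out of the ball of radius
`κ s ^ (1 / β)`, where `s` is large on the scale `δ`. -/
theorem mul_measure_fewNear_le (hδ : 0 < δ)
    (hc : 0 < c)
    (hD : ∀ ρ : ℝ, 1 ≤ ρ → ∀ k : ℕ, 0 < k →
      k * Real.exp (-(c / 4 * k * ρ ^ e)) ≤ D * ρ ^ (-K))
    (hk0 : 0 < k) (hk : k ≤ N * δ ^ e) {s R : ℝ} (hs1 : 1 ≤ s / δ) (hs4 : 4 ≤ c * (s / δ) ^ e)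
    (hball : ENNReal.ofReal (c * s ^ e) ≤ P.fst (Metric.ball x R)) :
    k * (Measure.pi fun _ : Fin N => P) (fewNear N k x R) ≤
      ENNReal.ofReal (D * (s / δ) ^ (-K)) := by
  have hs : 0 < s := by
    have := mul_le_mul_of_nonneg_right hs1 hδ.le
    rw [div_mul_cancel₀ _ hδ.ne'] at this
    linarith
  have hsδ : s ^ e = (s / δ) ^ e * δ ^ e := by
    rw [← Real.mul_rpow (by positivity) hδ.le, div_mul_cancel₀ _ hδ.ne']
  -- On the scale `δ` the lower bound `N * c * s ^ e` for the expected count exceeds `k` by the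
  -- factor `c * (s / δ) ^ e`, which `hs4` makes at least `4`.
  have hkq : k * (c * (s / δ) ^ e) ≤ N * (c * s ^ e) := by
    rw [hsδ]
    have := mul_le_mul_of_nonneg_right hk (show 0 ≤ c * (s / δ) ^ e by positivity)
    linarith
  have hk4 : 4 * (k : ℝ) ≤ N * (c * s ^ e) := by
    have := mul_le_mul_of_nonneg_left hs4 (show (0 : ℝ) ≤ k by positivity)
    linarith
  calc _ ≤ k * ENNReal.ofReal (Real.exp (-(N * (c * s ^ e) / 4))) := by
        gcongr
        exact measure_fewNear_le P x R hball hk4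
    _ = ENNReal.ofReal (k * Real.exp (-(N * (c * s ^ e) / 4))) := by
        rw [ENNReal.ofReal_mul (by positivity), ENNReal.ofReal_natCast]
    _ ≤ _ := by
        apply ENNReal.ofReal_le_ofReal
        refine le_trans (mul_le_mul_of_nonneg_left (Real.exp_le_exp.2 ?_) (by positivity))
          (hD (s / δ) hs1 k hk0)
        linarith

/-- The far bias of an arbitrary source. -/
theorem lintegral_farBias_le_of_bounded {η : EuclideanSpace ℝ (Fin d) → ℝ} {g : ℝ} (hg : 0 ≤ g)
    (hδ : 0 < δ) (hc : 0 < c)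
    (hD : ∀ ρ : ℝ, 1 ≤ ρ → ∀ k : ℕ, 0 < k →
      k * Real.exp (-(c / 4 * k * ρ ^ e)) ≤ D * ρ ^ (-K))
    (hk0 : 0 < k) (hkN : k ≤ N) (hk : k ≤ N * δ ^ e) {t R : ℝ} (ht1 : 1 ≤ t / δ)
    (ht4 : 4 ≤ c * (t / δ) ^ e)
    (hball : ENNReal.ofReal (c * t ^ e) ≤ P.fst (Metric.ball x R))
    (hb : ∀ y, g + |η y - 1 / 2| ≤ 1) :
    ∫⁻ s, ENNReal.ofReal (farBias η g R k s x) ∂(Measure.pi fun _ : Fin N => P) ≤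
      ENNReal.ofReal (D * (t / δ) ^ (-K)) := by
  -- A single shell suffices: each far neighbour has bias at most `1`.
  refine (lintegral_farBias_le (R := fun _ => R) (c := fun l => if l = 0 then 1 else 0) hg hkN
    (Filter.Eventually.of_forall fun y hy => ⟨0, hy, ?_⟩)).trans ?_
  · simpa using hb y
  · rw [tsum_eq_single 0 fun l hl => by simp [hl]]
    simpa using mul_measure_fewNear_le hδ hc hD hk0 hk ht1 ht4 hball

/-- The shells are open below and closed above, so an exact power of two belongs to the preceding
shell. -/
theorem exists_dyadic_shell {a u : ℝ} (ha : 0 < a) (hu : a < u) :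
    ∃ l : ℕ, 2 ^ l * a < u ∧ u ≤ 2 ^ (l + 1) * a := by
  obtain ⟨l, h1, h2⟩ := exists_nat_pow_near (y := (2 : ℝ)) (x := u / a)
    ((one_le_div ha).2 hu.le) (by norm_num)
  rcases h1.lt_or_eq with h1 | h1
  · exact ⟨l, (lt_div_iff₀ ha).1 h1, ((div_lt_iff₀ ha).1 h2).le⟩
  · have hl : l ≠ 0 := by
      rintro rfl
      rw [pow_zero, eq_div_iff ha.ne'] at h1
      linarith
    obtain ⟨l, rfl⟩ := Nat.exists_eq_succ_of_ne_zero hl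
    rw [eq_div_iff ha.ne'] at h1
    refine ⟨l, ?_, h1.symm.le⟩
    rw [← h1, Nat.succ_eq_add_one, pow_succ]
    have : 0 < 2 ^ l * a := by positivity
    linarith

/-- The far bias of a source whose signal is of the order of a power of the expert's signal. -/
theorem lintegral_farBias_le_of_power {η η₀ : EuclideanSpace ℝ (Fin d) → ℝ} {Cβ Cγ γ γmax t : ℝ}
    (hδ : 0 < δ) (hc : 0 < c) (he : 0 < e) (hβ : 0 < β) (hκ : 0 < κ) (hκβ : Cβ * κ ^ β ≤ 1 / 2)
    (hCβ : 0 < Cβ) (hK : γmax + 1 ≤ K) (hD0 : 0 < D)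
    (hD : ∀ ρ : ℝ, 1 ≤ ρ → ∀ k : ℕ, 0 < k →
      k * Real.exp (-(c / 4 * k * ρ ^ e)) ≤ D * ρ ^ (-K))
    (hk0 : 0 < k) (hkN : k ≤ N) (hk : k ≤ N * δ ^ e) (ht1 : 1 ≤ t / δ)
    (ht4 : 4 ≤ c * (t / δ) ^ e)
    (hball : ∀ s, 0 < s → s ≤ 1 / 2 →
      ENNReal.ofReal (c * s ^ e) ≤ P.fst (Metric.ball x (κ * s ^ (1 / β))))
    (hCγ : 0 < Cγ) (hγ : 0 < γ) (hγm : γ ≤ γmax) (ht : |η₀ x - 1 / 2| = t) (ht2 : t ≤ 1 / 2)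
    (hη₀ : ∀ y, η₀ y ∈ Icc (0 : ℝ) 1)
    (hae : ∀ᵐ y ∂P.fst, |η₀ y - η₀ x| ≤ Cβ * dist y x ^ β ∧
      |η y - 1 / 2| ≤ Cγ * |η₀ y - 1 / 2| ^ γ) :
    ∫⁻ s, ENNReal.ofReal (farBias η (Cγ * (t / 2) ^ γ) (κ * t ^ (1 / β)) k s x)
        ∂(Measure.pi fun _ : Fin N => P) ≤
      ENNReal.ofReal (k * (Cγ * (t / 2) ^ γ) * (4 * 8 ^ γmax * D * (t / δ) ^ (-K))) := by
  have ht0 : 0 < t := by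
    have := mul_le_mul_of_nonneg_right ht1 hδ.le
    rw [div_mul_cancel₀ _ hδ.ne'] at this
    linarith
  -- Bounds the bias on shell `l`, where the expert's signal is at most `2 ^ (l + 2) * t`. It grows
  -- like `2 ^ (l * γmax)`, while the probability of reaching that shell decays like `2 ^ (-l * K)`;
  -- `γmax + 1 ≤ K` makes the product geometric.
  let a : ℕ → ℝ := fun l => 2 * Cγ * t ^ γ * (2 ^ (l + 2)) ^ γmax
  have ha : ∀ l, 0 ≤ a l := fun l => by positivity
  have hclose : ∀ y s, 0 < s → |η₀ y - η₀ x| ≤ Cβ * dist y x ^ β →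
      dist y x < κ * s ^ (1 / β) → |η₀ y - 1 / 2| ≤ t + s / 2 := by
    intro y s hs hy hys
    have h1 : dist y x ^ β ≤ κ ^ β * s := by
      calc dist y x ^ β ≤ (κ * s ^ (1 / β)) ^ β := Real.rpow_le_rpow dist_nonneg hys.le hβ.le
        _ = κ ^ β * s := by
          rw [Real.mul_rpow hκ.le (by positivity), ← Real.rpow_mul hs.le, one_div_mul_cancel hβ.ne',
            Real.rpow_one]
    have h2 : Cβ * dist y x ^ β ≤ s / 2 := by
      calc Cβ * dist y x ^ β ≤ Cβ * (κ ^ β * s) := mul_le_mul_of_nonneg_left h1 hCβ.le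
        _ = Cβ * κ ^ β * s := by ring
        _ ≤ 1 / 2 * s := mul_le_mul_of_nonneg_right hκβ hs.le
        _ = s / 2 := by ring
    calc |η₀ y - 1 / 2| = |(η₀ x - 1 / 2) + (η₀ y - η₀ x)| := by congr 1; ring
      _ ≤ |η₀ x - 1 / 2| + |η₀ y - η₀ x| := abs_add_le _ _
      _ ≤ _ := by linarith
  have hshell : ∀ l : ℕ, ∀ y, |η₀ y - 1 / 2| ≤ 2 ^ (l + 2) * t →
      |η y - 1 / 2| ≤ Cγ * |η₀ y - 1 / 2| ^ γ → Cγ * (t / 2) ^ γ + |η y - 1 / 2| ≤ a l := by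
    intro l y h1 h2
    have hp : (1 : ℝ) ≤ 2 ^ (l + 2) := one_le_pow₀ (by norm_num)
    have h3 : |η₀ y - 1 / 2| ^ γ ≤ t ^ γ * (2 ^ (l + 2)) ^ γmax := by
      calc |η₀ y - 1 / 2| ^ γ ≤ (2 ^ (l + 2) * t) ^ γ :=
            Real.rpow_le_rpow (abs_nonneg _) h1 hγ.le
        _ = t ^ γ * (2 ^ (l + 2)) ^ γ := by rw [Real.mul_rpow (by positivity) ht0.le, mul_comm]
        _ ≤ _ := by
          refine mul_le_mul_of_nonneg_left ?_ (by positivity)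
          exact Real.rpow_le_rpow_of_exponent_le hp hγm
    have h4 : (t / 2) ^ γ ≤ t ^ γ * (2 ^ (l + 2)) ^ γmax := by
      calc (t / 2) ^ γ ≤ t ^ γ * 1 := by
            rw [mul_one]
            exact Real.rpow_le_rpow (by positivity) (by linarith) hγ.le
        _ ≤ _ := mul_le_mul_of_nonneg_left (Real.one_le_rpow hp (by linarith)) (by positivity)
    have h5 := mul_le_mul_of_nonneg_left h3 hCγ.le
    have h6 := mul_le_mul_of_nonneg_left h4 hCγ.le
    simp only [a]
    linarith
  -- Shells with `2 ^ l * t > 1 / 2` need no cost, because the expert's signal never exceeds `1/2`;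
  -- the mass bound `hball` is available exactly for the others.
  refine (lintegral_farBias_le (R := fun l => κ * (2 ^ l * t) ^ (1 / β))
    (c := fun l => if 2 ^ l * t ≤ 1 / 2 then ENNReal.ofReal (a l) else 0) (by positivity) hkN
    (hae.mono fun y hy hr => ?_)).trans ?_
  · obtain ⟨hy1, hy2⟩ := hy
    rcases le_or_gt |η₀ y - 1 / 2| (2 * t) with hu | hu
    · refine ⟨0, by simpa using hr, ?_⟩
      rw [if_pos (by simpa using ht2)]
      exact ENNReal.ofReal_le_ofReal (hshell 0 y (by linarith) hy2)
    · obtain ⟨l, hl1, hl2⟩ := exists_dyadic_shell (by positivity) hu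
      have hpos : 0 < 2 ^ l * t := by positivity
      have hhalf : |η₀ y - 1 / 2| ≤ 1 / 2 := by
        have := hη₀ y
        rw [abs_le]
        constructor <;> linarith [this.1, this.2]
      refine ⟨l, ?_, ?_⟩
      -- A closer point would have expert signal at most `t + 2 ^ l * t / 2`, below the lower end `2
      -- ^ l * (2 * t)` of its shell.
      · by_contra hlt
        have h1 := hclose y (2 ^ l * t) hpos hy1 (not_le.1 hlt)
        have h2 : t ≤ 2 ^ l * t := le_mul_of_one_le_left ht0.le (one_le_pow₀ (by norm_num))
        linarith
      · rw [if_pos (by linarith)]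
        refine ENNReal.ofReal_le_ofReal (hshell l y (hl2.trans (le_of_eq ?_)) hy2)
        ring
  -- `8 ^ γmax` collects `4 ^ γmax` from the shells and `2 ^ γmax` from replacing `t` by `t / 2`.
  -- The factor `k ≥ 1` is a loss accepted so that the weighted costs sum to a multiple of the total
  -- signal.
  · let b : ℝ := k * (Cγ * (t / 2) ^ γ) * (2 * 8 ^ γmax * D * (t / δ) ^ (-K))
    have hb : 0 ≤ b := by positivity
    have hkt : ∀ l : ℕ, (if 2 ^ l * t ≤ 1 / 2 then ENNReal.ofReal (a l) else 0) *
        (k * (Measure.pi fun _ : Fin N => P) (fewNear N k x (κ * (2 ^ l * t) ^ (1 / β)))) ≤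
        ENNReal.ofReal (b * (1 / 2) ^ l) := by
      intro l
      split_ifs with hl
      · have hp : (1 : ℝ) ≤ 2 ^ l := one_le_pow₀ (by norm_num)
        have htl : t / δ ≤ 2 ^ l * t / δ := by
          gcongr
          exact le_mul_of_one_le_left ht0.le hp
        have htl4 : 4 ≤ c * (2 ^ l * t / δ) ^ e :=
          ht4.trans (mul_le_mul_of_nonneg_left (Real.rpow_le_rpow (by positivity) htl he.le) hc.le)
        have h1 := mul_measure_fewNear_le hδ hc hD hk0 hk (ht1.trans htl) htl4
          (hball (2 ^ l * t) (by positivity) hl)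
        refine (mul_le_mul_right h1 _).trans ?_
        rw [← ENNReal.ofReal_mul (ha l)]
        apply ENNReal.ofReal_le_ofReal
        have h2 : (2 ^ l * t / δ) ^ (-K) = (2 ^ l) ^ (-K) * (t / δ) ^ (-K) := by
          rw [mul_div_assoc, Real.mul_rpow (by positivity) (by positivity)]
        have h3 : ((2 : ℝ) ^ (l + 2)) ^ γmax = (2 ^ l) ^ γmax * 4 ^ γmax := by
          rw [pow_add, Real.mul_rpow (by positivity) (by positivity)]
          norm_num
        have h4 : ((2 : ℝ) ^ l) ^ γmax * (2 ^ l) ^ (-K) ≤ (1 / 2) ^ l := by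
          rw [← Real.rpow_add (by positivity)]
          calc ((2 : ℝ) ^ l) ^ (γmax + -K) ≤ (2 ^ l) ^ (-1 : ℝ) :=
                Real.rpow_le_rpow_of_exponent_le hp (by linarith)
            _ = (1 / 2) ^ l := by rw [Real.rpow_neg_one, one_div, inv_pow]
        have h5 : t ^ γ ≤ (t / 2) ^ γ * 2 ^ γmax := by
          calc t ^ γ = (t / 2) ^ γ * 2 ^ γ := by
                rw [← Real.mul_rpow (by positivity) (by norm_num), div_mul_cancel₀ _ two_ne_zero]
            _ ≤ _ := mul_le_mul_of_nonneg_left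
                (Real.rpow_le_rpow_of_exponent_le (by norm_num) hγm) (by positivity)
        have h6 : (8 : ℝ) ^ γmax = 2 ^ γmax * 4 ^ γmax := by
          rw [← Real.mul_rpow (by norm_num) (by norm_num)]
          norm_num
        have hk1 : (1 : ℝ) ≤ k := by exact_mod_cast hk0
        calc a l * (D * (2 ^ l * t / δ) ^ (-K))
            = 2 * Cγ * 4 ^ γmax * D * (t / δ) ^ (-K) *
                (t ^ γ * ((2 ^ l) ^ γmax * (2 ^ l) ^ (-K))) := by
              simp only [a]
              rw [h2, h3]
              ring
          _ ≤ 2 * Cγ * 4 ^ γmax * D * (t / δ) ^ (-K) *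
                ((t / 2) ^ γ * 2 ^ γmax * (1 / 2) ^ l) := by
              refine mul_le_mul_of_nonneg_left ?_ (by positivity)
              exact mul_le_mul h5 h4 (by positivity) (by positivity)
          _ = 1 * ((Cγ * (t / 2) ^ γ) * (2 * 8 ^ γmax * D * (t / δ) ^ (-K)) * (1 / 2) ^ l) := by
              rw [h6]
              ring
          _ ≤ k * ((Cγ * (t / 2) ^ γ) * (2 * 8 ^ γmax * D * (t / δ) ^ (-K)) * (1 / 2) ^ l) :=
              mul_le_mul_of_nonneg_right hk1 (by positivity)
          _ = _ := by
              simp only [b]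
              ring
      · simp
    refine (ENNReal.tsum_le_tsum hkt).trans ?_
    have hsum : Summable fun l : ℕ => b * (1 / 2) ^ l := summable_geometric_two.mul_left b
    rw [← ENNReal.ofReal_tsum_of_nonneg (fun l => by positivity) hsum, tsum_mul_left,
      tsum_geometric_two]
    apply ENNReal.ofReal_le_ofReal
    simp only [b]
    linarith

end Bias

/-! ### The pointwise error of the weighted vote -/

section Pointwise

variable {d m : ℕ} {α β Cα Cβ μlo μhi cμ rμ : ℝ} {P : Fin (m + 1) → Measure (Obs d)}
  {η : Fin (m + 1) → EuclideanSpace ℝ (Fin d) → ℝ}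

theorem IsRegularCrowd.ae_mem_support (h : IsRegularCrowd α β Cα Cβ μlo μhi cμ rμ P η)
    (i : Fin (m + 1)) : ∀ᵐ y ∂(P i).fst, y ∈ (P 0).fst.support := by
  rw [← h.common_support i]
  exact Measure.support_mem_ae

theorem IsRegularCrowd.measure_ball_ge (h : IsRegularCrowd α β Cα Cβ μlo μhi cμ rμ P η)
    (hβ : 0 < β) (hμlo : 0 < μlo) (hcμ : 0 < cμ) {κ : ℝ} (hκ : 0 < κ) (hκr : κ ≤ rμ)
    {x : EuclideanSpace ℝ (Fin d)} (hx : x ∈ (P 0).fst.support) (i : Fin (m + 1)) {s : ℝ}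
    (hs : 0 < s) (hs1 : s ≤ 1) :
    ENNReal.ofReal (μlo * cμ * (volume : Measure (EuclideanSpace ℝ (Fin d))).real
      (Metric.ball 0 1) * κ ^ d * s ^ ((d : ℝ) / β)) ≤
      (P i).fst (Metric.ball x (κ * s ^ (1 / β))) := by
  have := h.prob i
  have hr : 0 < κ * s ^ (1 / β) := by positivity
  have hrr : κ * s ^ (1 / β) ≤ rμ := by
    have : s ^ (1 / β) ≤ 1 := Real.rpow_le_one hs.le hs1 (by positivity)
    exact (mul_le_of_le_one_right hκ.le this).trans hκr
  have h1 := _root_.measure_ball_ge hμlo.le hcμ.le hr (h.regular_support x hx _ hr hrr)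
    ((h.density i).mono fun y hy => hy.1)
  refine le_trans (le_of_eq ?_) h1
  have : (s ^ (1 / β)) ^ d = s ^ ((d : ℝ) / β) := by
    rw [← Real.rpow_natCast, ← Real.rpow_mul hs.le]
    congr 1
    ring
  rw [mul_pow, this]
  ring_nf

theorem abs_sub_half_le {u : ℝ} (hu : u ∈ Icc (0 : ℝ) 1) : |u - 1 / 2| ≤ 1 / 2 := by
  rw [abs_le]
  constructor <;> linarith [hu.1, hu.2]

/-- Sources whose signal has the sign of the expert's signal and the strength given by `γ`, `Cγ`
have a signal of the right sign near `x`. -/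
theorem signal_ge_of_near {u u₀ v₀ t C γ σ : ℝ} (hσ : |σ| = 1) (ht : 0 < t) (hC : 0 ≤ C)
    (hγ : 0 ≤ γ) (hv₀ : σ * (v₀ - 1 / 2) = t) (hclose : |u₀ - v₀| ≤ t / 2)
    (hsign : 0 ≤ (u - 1 / 2) * (u₀ - 1 / 2)) (hstrength : C * |u₀ - 1 / 2| ^ γ ≤ |u - 1 / 2|) :
    C * (t / 2) ^ γ ≤ σ * (u - 1 / 2) := by
  have hσ2 : σ * σ = 1 := by rw [← abs_mul_abs_self, hσ, one_mul]
  have h1 : t / 2 ≤ σ * (u₀ - 1 / 2) := by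
    have h2 : |σ * (u₀ - v₀)| ≤ t / 2 := by rwa [abs_mul, hσ, one_mul]
    have h3 := (abs_le.1 h2).1
    linarith [mul_sub σ u₀ v₀, mul_sub σ u₀ (1 / 2), mul_sub σ v₀ (1 / 2)]
  have h4 : 0 ≤ σ * (u - 1 / 2) := by
    have h5 : 0 ≤ (σ * (u - 1 / 2)) * (σ * (u₀ - 1 / 2)) := by
      calc 0 ≤ (u - 1 / 2) * (u₀ - 1 / 2) := hsign
        _ = (σ * σ) * ((u - 1 / 2) * (u₀ - 1 / 2)) := by rw [hσ2, one_mul]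
        _ = _ := by ring
    exact nonneg_of_mul_nonneg_left h5 (by linarith)
  have h6 : σ * (u - 1 / 2) = |u - 1 / 2| := by
    rw [← abs_of_nonneg h4, abs_mul, hσ, one_mul]
  have h7 : t / 2 ≤ |u₀ - 1 / 2| := by
    calc t / 2 ≤ |σ * (u₀ - 1 / 2)| := h1.trans (le_abs_self _)
      _ = _ := by rw [abs_mul, hσ, one_mul]
  rw [h6]
  exact le_trans (mul_le_mul_of_nonneg_left
    (Real.rpow_le_rpow (by positivity) h7 hγ) hC) hstrength

set_option maxHeartbeats 1600000 in
/-- The probability that the weighted vote at `x` is wrong decays as fast as any power of the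
strength of the signal at `x`, relative to the resolution `δ` of the sample. The sources in `A` may
have arbitrary signals away from `x`, if they have a small total weight; the signal of the other
sources is of the order of a bounded power of the signal of the expert. -/
theorem exists_vote_error_le (hd : 0 < d) {γlo Cγlo v γmax K : ℝ}
    (hβ : 0 < β) (hCβ : 0 < Cβ) (hμlo : 0 < μlo) (hcμ : 0 < cμ) (hrμ : 0 < rμ)
    (hγlo : 0 < γlo) (hCγlo : 0 < Cγlo) (hv : 0 < v) (hK0 : 0 ≤ K) (hK : γmax + 1 ≤ K) :
    ∃ C : ℝ, 0 < C ∧ ∀ {m : ℕ} {γ Cγ : Fin (m + 1) → ℝ} {n k : Fin (m + 1) → ℕ}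
      {w : Fin (m + 1) → ℝ} {δ : ℝ} {A : Set (Fin (m + 1))} {α Cα μhi : ℝ}
      {P : Fin (m + 1) → Measure (Obs d)} {η : Fin (m + 1) → EuclideanSpace ℝ (Fin d) → ℝ},
      0 < δ → (∀ i, γlo ≤ γ i) → (∀ i, Cγlo ≤ Cγ i) → (∀ i, k i ≤ n i) →
      (∀ i, (k i : ℝ) ≤ n i * δ ^ ((d : ℝ) / β)) → (∀ i, w i = δ ^ γ i) →
      v ≤ ∑ i, (k i : ℝ) * w i ^ 2 →
      ∑ i, (A ∩ {i | 0 < k i}).indicator w i ≤ 1 →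
      (∀ i, i ∉ A → γ i ≤ γmax) →
      IsRegularCrowd α β Cα Cβ μlo μhi cμ rμ P η →
      (∀ i, ∀ y ∈ (P 0).fst.support, 0 ≤ (η i y - 1 / 2) * (η 0 y - 1 / 2) ∧
        Cγ i * |η 0 y - 1 / 2| ^ γ i ≤ |η i y - 1 / 2|) →
      (∀ i, i ∉ A → ∀ y ∈ (P 0).fst.support, |η i y - 1 / 2| ≤ Cγ i * |η 0 y - 1 / 2| ^ γ i) →
      ∀ x ∈ (P 0).fst.support, ∀ σ : ℝ, |σ| = 1 → σ * (η 0 x - 1 / 2) = |η 0 x - 1 / 2| →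
      0 < |η 0 x - 1 / 2| →
      crowdLaw n P {s | ∑ i, w i * (σ * (neighborLabelSum (s i) (k i) x - k i / 2)) ≤ 0} ≤
        ENNReal.ofReal (C * (|η 0 x - 1 / 2| / δ) ^ (-K)) := by
  classical
  set e : ℝ := (d : ℝ) / β with he_def
  have he : 0 < e := by positivity
  -- Small enough that `η 0` moves by at most `s / 2` within radius `κ * s ^ (1 / β)`, and that for
  -- `s ≤ 1` the support is regular at this radius.
  set κ : ℝ := min ((1 / (2 * Cβ)) ^ (1 / β)) rμ with hκ_def
  have hκ : 0 < κ := lt_min (by positivity) hrμ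
  have hκβ : Cβ * κ ^ β ≤ 1 / 2 := by
    calc Cβ * κ ^ β ≤ Cβ * ((1 / (2 * Cβ)) ^ (1 / β)) ^ β :=
          mul_le_mul_of_nonneg_left (Real.rpow_le_rpow hκ.le (min_le_left _ _) hβ.le) hCβ.le
      _ = 1 / 2 := by
          rw [← Real.rpow_mul (by positivity), one_div_mul_cancel hβ.ne', Real.rpow_one]
          field_simp
  set c : ℝ := μlo * cμ * (volume : Measure (EuclideanSpace ℝ (Fin d))).real
      (Metric.ball 0 1) * κ ^ d with hc_def
  have hball0 : 0 < (volume : Measure (EuclideanSpace ℝ (Fin d))).real (Metric.ball 0 1) :=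
    ENNReal.toReal_pos (Metric.measure_ball_pos _ _ one_pos).ne' measure_ball_lt_top.ne
  have hc : 0 < c := by positivity
  obtain ⟨D, hD0, hD⟩ := exists_mul_exp_neg_le (K := K) (show 0 < c / 4 by positivity) he
  obtain ⟨D', hD'0, hD'⟩ := exists_mul_exp_neg_le (K := K)
    (show 0 < Cγlo ^ 2 * v / 2 * (1 / 2) ^ (2 * γlo) by positivity)
    (show 0 < 2 * γlo by positivity)
  -- Below `ρ₀` the bound is trivial through the term `ρ₀ ^ K`. Above it `ρ / 2 ≥ 1`, and `c * ρ ^ e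
  -- ≥ 4` as the Chernoff bound requires.
  set ρ₀ : ℝ := max 2 ((4 / c) ^ (1 / e)) with hρ₀_def
  have hρ₀ : 0 < ρ₀ := lt_of_lt_of_le two_pos (le_max_left _ _)
  set C₂ : ℝ := 4 * 8 ^ γmax * D with hC₂_def
  have hC₂ : 0 < C₂ := by positivity
  refine ⟨ρ₀ ^ K + (D' + 2 * D / (Cγlo * v) + 2 * C₂), by positivity, ?_⟩
  intro m γ Cγ n k w δ A α Cα μhi P η hδ hγ hCγ hkn hkδ hw hV hA hγmax hreg hdrift hpow x hx σ hσ
    hσx ht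
  have hprob := hreg.prob
  set t : ℝ := |η 0 x - 1 / 2| with ht_def
  set ρ : ℝ := t / δ with hρ_def
  have hρ : 0 < ρ := by positivity
  have ht2 : t ≤ 1 / 2 := abs_sub_half_le ((hreg.regression 0).mem_unit x)
  have hw0 : ∀ i, 0 < w i := fun i => by rw [hw i]; positivity
  have hγ0 : ∀ i, 0 < γ i := fun i => hγlo.trans_le (hγ i)
  have hCγ0 : ∀ i, 0 < Cγ i := fun i => hCγlo.trans_le (hCγ i)
  rcases lt_or_ge ρ ρ₀ with hsmall | hlarge
  · refine prob_le_one.trans ?_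
    rw [ENNReal.one_le_ofReal]
    calc (1 : ℝ) = ρ ^ K * ρ ^ (-K) := by rw [← Real.rpow_add hρ]; simp
      _ ≤ _ := by
        refine mul_le_mul_of_nonneg_right ?_ (by positivity)
        have h1 : ρ ^ K ≤ ρ₀ ^ K := Real.rpow_le_rpow hρ.le hsmall.le hK0
        have h2 : 0 < D' + 2 * D / (Cγlo * v) + 2 * C₂ := by positivity
        linarith
  have hρ2 : 2 ≤ ρ := (le_max_left _ _).trans hlarge
  have hρ1 : 1 ≤ ρ := by linarith
  have hρ4 : 4 ≤ c * ρ ^ e := by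
    have h1 : ((4 / c) ^ (1 / e)) ^ e ≤ ρ ^ e :=
      Real.rpow_le_rpow (by positivity) ((le_max_right _ _).trans hlarge) he.le
    rw [← Real.rpow_mul (by positivity), one_div_mul_cancel he.ne', Real.rpow_one,
      div_le_iff₀ hc] at h1
    linarith
  set g : Fin (m + 1) → ℝ := fun i => Cγ i * (t / 2) ^ γ i with hg_def
  have hg : ∀ i, 0 < g i := fun i => by
    have := hCγ0 i
    simp only [hg_def]
    positivity
  set V : ℝ := ∑ i, (k i : ℝ) * w i ^ 2 with hV_def
  set G : ℝ := ∑ i, w i * (k i * g i) with hG_def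
  have hV0 : 0 < V := hv.trans_le hV
  -- The point of the weights: `(t / 2) ^ γ i = w i * (ρ / 2) ^ γ i` turns each signal term into a
  -- multiple of the variance term `k i * w i ^ 2`.
  have hGV : Cγlo * (ρ / 2) ^ γlo * V ≤ G := by
    rw [hV_def, hG_def, Finset.mul_sum]
    refine Finset.sum_le_sum fun i _ => ?_
    have h1 : (t / 2) ^ γ i = w i * (ρ / 2) ^ γ i := by
      rw [hw i, ← Real.mul_rpow hδ.le (by positivity), hρ_def]
      congr 1
      field_simp
    have h2 : Cγlo * (ρ / 2) ^ γlo ≤ Cγ i * (ρ / 2) ^ γ i :=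
      mul_le_mul (hCγ i) (Real.rpow_le_rpow_of_exponent_le (by linarith) (hγ i)) (by positivity)
        (hCγ0 i).le
    simp only [hg_def]
    rw [h1]
    calc _ ≤ Cγ i * (ρ / 2) ^ γ i * (k i * w i ^ 2) :=
          mul_le_mul_of_nonneg_right h2 (by have := hw0 i; positivity)
      _ = _ := by ring
  have hGv : Cγlo * v ≤ G := by
    have h1 : 1 ≤ (ρ / 2) ^ γlo := Real.one_le_rpow (by linarith) hγlo.le
    calc Cγlo * v ≤ Cγlo * V := mul_le_mul_of_nonneg_left hV hCγlo.le
      _ = Cγlo * 1 * V := by ring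
      _ ≤ Cγlo * (ρ / 2) ^ γlo * V := by gcongr
      _ ≤ G := hGV
  have hG0 : 0 < G := lt_of_lt_of_le (by positivity) hGv
  have hclose : ∀ y ∈ (P 0).fst.support, |η 0 y - η 0 x| ≤ Cβ * dist y x ^ β := by
    intro y hy
    rw [dist_eq_norm]
    exact hreg.smooth y hy x hx
  have hsig : ∀ i, ∀ᵐ y ∂(P i).fst, dist y x < κ * t ^ (1 / β) → g i ≤ σ * (η i y - 1 / 2) := by
    intro i
    refine (hreg.ae_mem_support i).mono fun y hy hyx => ?_
    refine signal_ge_of_near hσ ht (hCγ0 i).le (hγ0 i).le hσx ?_ (hdrift i y hy).1 (hdrift i y hy).2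
    calc |η 0 y - η 0 x| ≤ Cβ * dist y x ^ β := hclose y hy
      _ ≤ Cβ * (κ * t ^ (1 / β)) ^ β :=
          mul_le_mul_of_nonneg_left (Real.rpow_le_rpow dist_nonneg hyx.le hβ.le) hCβ.le
      _ = Cβ * κ ^ β * t := by
          rw [Real.mul_rpow hκ.le (by positivity), ← Real.rpow_mul ht.le,
            one_div_mul_cancel hβ.ne', Real.rpow_one]
          ring
      _ ≤ 1 / 2 * t := mul_le_mul_of_nonneg_right hκβ ht.le
      _ = t / 2 := by ring
  have hball : ∀ i s, 0 < s → s ≤ 1 / 2 →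
      ENNReal.ofReal (c * s ^ e) ≤ (P i).fst (Metric.ball x (κ * s ^ (1 / β))) := fun i s hs hs2 =>
    hreg.measure_ball_ge hβ hμlo hcμ hκ (min_le_right _ _) hx i hs (by linarith)
  set W : Fin (m + 1) → ℝ := (A ∩ {i | 0 < k i}).indicator w with hW_def
  have hW0 : ∀ i, 0 ≤ W i := fun i => indicator_nonneg (fun i _ => (hw0 i).le) i
  have hbias : ∀ i, ENNReal.ofReal (w i) *
      ∫⁻ s, ENNReal.ofReal (farBias (η i) (g i) (κ * t ^ (1 / β)) (k i) s x)
        ∂(Measure.pi fun _ : Fin (n i) => P i) ≤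
      ENNReal.ofReal (W i * (D * ρ ^ (-K)) + w i * (k i * g i) * (C₂ * ρ ^ (-K))) := by
    intro i
    rcases Nat.eq_zero_or_pos (k i) with hki | hki
    · have : ∀ s : Fin (n i) → Obs d,
          farBias (η i) (g i) (κ * t ^ (1 / β)) (k i) s x = 0 := fun s => by simp [farBias, hki]
      simp_rw [this]
      simp
    · by_cases hi : i ∈ A
      · have h1 := lintegral_farBias_le_of_bounded (P := P i) (η := η i) (x := x) (hg i).le hδ hc hD
          hki (hkn i) (hkδ i) hρ1 hρ4 (hball i t ht ht2) (fun y => by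
            have h2 := abs_sub_half_le ((hreg.regression i).mem_unit y)
            have h3 := abs_sub_half_le ((hreg.regression i).mem_unit x)
            -- The drift bound at `x` itself gives `g i ≤ |η i x - 1/2| ≤ 1/2`.
            have h4 := (hdrift i x hx).2
            have h5 : (t / 2) ^ γ i ≤ t ^ γ i :=
              Real.rpow_le_rpow (by positivity) (by linarith) (hγ0 i).le
            have h6 := mul_le_mul_of_nonneg_left h5 (hCγ0 i).le
            simp only [hg_def]
            linarith)
        refine (mul_le_mul_right h1 _).trans ?_
        rw [← ENNReal.ofReal_mul (hw0 i).le]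
        apply ENNReal.ofReal_le_ofReal
        have h7 : W i = w i := indicator_of_mem (show i ∈ A ∩ {i | 0 < k i} from ⟨hi, hki⟩) w
        rw [h7]
        have := hw0 i
        have := hg i
        have h8 : 0 ≤ w i * (k i * g i) * (C₂ * ρ ^ (-K)) := by positivity
        linarith
      · have h1 := lintegral_farBias_le_of_power (P := P i) (η := η i) (η₀ := η 0) (x := x)
          (γmax := γmax) hδ hc he hβ hκ hκβ hCβ hK hD0 hD hki (hkn i) (hkδ i) hρ1 hρ4 (hball i)
          (hCγ0 i) (hγ0 i) (hγmax i hi) rfl ht2 (hreg.regression 0).mem_unit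
          ((hreg.ae_mem_support i).mono fun y hy => ⟨hclose y hy, hpow i hi y hy⟩)
        refine (mul_le_mul_right h1 _).trans ?_
        rw [← ENNReal.ofReal_mul (hw0 i).le]
        apply ENNReal.ofReal_le_ofReal
        have h2 : 0 ≤ W i * (D * ρ ^ (-K)) := mul_nonneg (hW0 i) (by positivity)
        refine le_trans (le_of_eq ?_) (le_add_of_nonneg_left h2)
        ring
  refine (crowdLaw_vote_le hreg.regression hkn (fun i => (hw0 i).le) (fun i => (hg i).le) x hσ hsig
    hG0 hV0 rfl rfl).trans ?_
  calc _ ≤ ENNReal.ofReal (D' * ρ ^ (-K)) + ENNReal.ofReal (2 / G) *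
        ∑ i, ENNReal.ofReal (W i * (D * ρ ^ (-K)) + w i * (k i * g i) * (C₂ * ρ ^ (-K))) := by
        gcongr with i
        · have h1 := hD' ρ hρ1 1 one_pos
          rw [Nat.cast_one, one_mul, mul_one] at h1
          refine le_trans (Real.exp_le_exp.2 (neg_le_neg ?_)) h1
          rw [le_div_iff₀ (by positivity)]
          have h2 : (1 / 2 : ℝ) ^ (2 * γlo) * ρ ^ (2 * γlo) = ((ρ / 2) ^ γlo) ^ 2 := by
            rw [← Real.mul_rpow (by norm_num) hρ.le, mul_comm 2 γlo, Real.rpow_mul (by positivity)]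
            norm_num
            ring_nf
          calc Cγlo ^ 2 * v / 2 * (1 / 2) ^ (2 * γlo) * ρ ^ (2 * γlo) * (2 * V)
              = Cγlo ^ 2 * ((ρ / 2) ^ γlo) ^ 2 * V * v := by
                rw [← h2]
                ring
            _ ≤ Cγlo ^ 2 * ((ρ / 2) ^ γlo) ^ 2 * V * V :=
                mul_le_mul_of_nonneg_left hV (by positivity)
            _ = (Cγlo * (ρ / 2) ^ γlo * V) ^ 2 := by ring
            _ ≤ G ^ 2 := pow_le_pow_left₀ (by positivity) hGV 2
        · exact hbias i
    _ = ENNReal.ofReal (D' * ρ ^ (-K) + 2 / G * ((∑ i, W i) * (D * ρ ^ (-K)) +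
          G * (C₂ * ρ ^ (-K)))) := by
        have hnn : ∀ i, 0 ≤ W i * (D * ρ ^ (-K)) + w i * (k i * g i) * (C₂ * ρ ^ (-K)) := by
          intro i
          have := hW0 i
          have := hw0 i
          have := hg i
          positivity
        rw [← ENNReal.ofReal_sum_of_nonneg (fun i _ => hnn i), ← ENNReal.ofReal_mul (by positivity),
          ← ENNReal.ofReal_add (by positivity)
            (mul_nonneg (by positivity) (Finset.sum_nonneg fun i _ => hnn i)),
          Finset.sum_add_distrib, ← Finset.sum_mul, ← Finset.sum_mul]
    _ ≤ _ := by
        apply ENNReal.ofReal_le_ofReal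
        have h1 : (∑ i, W i) * (D * ρ ^ (-K)) ≤ 1 * (D * ρ ^ (-K)) :=
          mul_le_mul_of_nonneg_right hA (by positivity)
        -- Needed only for the sources in `A`; for the others `G` cancels.
        have h2 : 2 / G ≤ 2 / (Cγlo * v) := by gcongr
        calc D' * ρ ^ (-K) + 2 / G * ((∑ i, W i) * (D * ρ ^ (-K)) + G * (C₂ * ρ ^ (-K)))
            ≤ D' * ρ ^ (-K) + 2 / G * (1 * (D * ρ ^ (-K)) + G * (C₂ * ρ ^ (-K))) := by gcongr
          _ = D' * ρ ^ (-K) + 2 / G * (D * ρ ^ (-K)) + 2 * (C₂ * ρ ^ (-K)) := by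
              field_simp
              ring
          _ ≤ D' * ρ ^ (-K) + 2 / (Cγlo * v) * (D * ρ ^ (-K)) + 2 * (C₂ * ρ ^ (-K)) := by gcongr
          _ = (D' + 2 * D / (Cγlo * v) + 2 * C₂) * ρ ^ (-K) := by ring
          _ ≤ _ := by
              refine mul_le_mul_of_nonneg_right ?_ (by positivity)
              have : 0 < ρ₀ ^ K := by positivity
              linarith

end Pointwise

/-! ### Excess risk -/

section Risk

variable {d : ℕ} {P : Measure (Obs d)} {η : EuclideanSpace ℝ (Fin d) → ℝ}
  {f g : EuclideanSpace ℝ (Fin d) → Bool}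

/-- The classifier value `b` differs from the Bayes decision for the regression value `u ≠ 1 / 2`. -/
def WrongDecision (u : ℝ) (b : Bool) : Prop :=
  (1 / 2 < u ∧ b = false) ∨ (u < 1 / 2 ∧ b = true)

theorem measurableSet_wrongDecision {Ω : Type*} [MeasurableSpace Ω] {u : Ω → ℝ} {b : Ω → Bool}
    (hu : Measurable u) (hb : Measurable b) : MeasurableSet {ω | WrongDecision (u ω) (b ω)} :=
  ((measurableSet_lt measurable_const hu).inter (hb (measurableSet_singleton false))).union
    ((measurableSet_lt hu measurable_const).inter (hb (measurableSet_singleton true)))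

open Classical in
/-- The loss of a classifier relative to the Bayes classifier at a point. -/
noncomputable def pointRegret (u : ℝ) (b : Bool) : ENNReal :=
  if WrongDecision u b then ENNReal.ofReal (2 * |u - 1 / 2|) else 0

theorem measurable_pointRegret {Ω : Type*} [MeasurableSpace Ω] {u : Ω → ℝ} {b : Ω → Bool}
    (hu : Measurable u) (hb : Measurable b) : Measurable fun ω => pointRegret (u ω) (b ω) := by
  classical
  exact Measurable.ite (measurableSet_wrongDecision hu hb)
    ((hu.sub_const _).abs.const_mul _).ennreal_ofReal measurable_const

theorem pointRegret_le_one {u : ℝ} (hu : u ∈ Icc (0 : ℝ) 1) (b : Bool) : pointRegret u b ≤ 1 := by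
  unfold pointRegret
  split_ifs
  · rw [← ENNReal.ofReal_one]
    apply ENNReal.ofReal_le_ofReal
    linarith [abs_sub_half_le hu]
  · exact zero_le

theorem IsRegressionFunction.measure_misclass [IsProbabilityMeasure P]
    (h : IsRegressionFunction P η) (hf : Measurable f) :
    P {z | f z.1 ≠ z.2} =
      ∫⁻ x, ENNReal.ofReal (if f x = true then 1 - η x else η x) ∂P.fst := by
  have hm : ∀ b, MeasurableSet {x | f x = b} := fun b => hf (measurableSet_singleton b)
  have hset : {z : Obs d | f z.1 ≠ z.2} = {x | f x = true} ×ˢ {false} ∪ {x | f x = true}ᶜ ×ˢ {true} := by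
    ext ⟨x, b⟩
    cases b <;> simp
  have hdisj : Disjoint ({x | f x = true} ×ˢ {false} : Set (Obs d))
      ({x | f x = true}ᶜ ×ˢ {true}) := by
    rw [Set.disjoint_left]
    rintro ⟨x, b⟩ hb hb'
    exact absurd (hb.2.symm.trans hb'.2) (by simp)
  rw [hset, measure_union hdisj ((hm true).compl.prod (measurableSet_singleton _)),
    h.prob_false (hm true), h.prob_true _ (hm true).compl]
  refine Eq.trans ?_ (lintegral_add_compl _ (hm true))
  congr 1
  · exact setLIntegral_congr_fun (hm true) fun x hx => by
      have : f x = true := hx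
      simp only [this, if_true]
  · exact setLIntegral_congr_fun (hm true).compl fun x hx => by
      have : ¬ f x = true := hx
      simp only [this, Bool.false_eq_true, if_false]

/-- The comparison is with every measurable `g`, so neither a Bayes classifier nor the attainment of
the infimum is needed. -/
theorem IsRegressionFunction.measure_misclass_le [IsProbabilityMeasure P]
    (h : IsRegressionFunction P η) (hf : Measurable f) (hg : Measurable g) :
    P {z | f z.1 ≠ z.2} ≤ P {z | g z.1 ≠ z.2} + ∫⁻ x, pointRegret (η x) (f x) ∂P.fst := by
  rw [h.measure_misclass hf, h.measure_misclass hg,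
    ← lintegral_add_right _ (measurable_pointRegret h.measurable hf)]
  refine lintegral_mono fun x => ?_
  have hu := h.mem_unit x
  have h0 : ∀ b : Bool, 0 ≤ (if b = true then 1 - η x else η x) := fun b => by
    split_ifs
    exacts [by linarith [hu.2], hu.1]
  by_cases hw : WrongDecision (η x) (f x)
  · rw [pointRegret, if_pos hw, ← ENNReal.ofReal_add (h0 (g x)) (by positivity)]
    apply ENNReal.ofReal_le_ofReal
    rcases hw with ⟨hη, hfx⟩ | ⟨hη, hfx⟩ <;> rw [hfx]
    · rw [abs_of_pos (by linarith)]
      cases g x <;> simp <;> linarith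
    · rw [abs_of_neg (by linarith)]
      cases g x <;> simp <;> linarith
  · rw [pointRegret, if_neg hw, add_zero]
    apply ENNReal.ofReal_le_ofReal
    by_contra hlt
    apply hw
    cases hfx : f x <;> cases hgx : g x <;> simp [hfx, hgx] at hlt
    · exact Or.inl ⟨by linarith, rfl⟩
    · exact Or.inr ⟨by linarith, rfl⟩

theorem misclassRisk_mem_Icc [IsProbabilityMeasure P] : misclassRisk P f ∈ Icc (0 : ℝ) 1 :=
  ⟨measureReal_nonneg, measureReal_le_one⟩

theorem bddBelow_misclassRisk [IsProbabilityMeasure P] :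
    BddBelow (range fun g : {g : EuclideanSpace ℝ (Fin d) → Bool // Measurable g} =>
      misclassRisk P g.1) :=
  ⟨0, by rintro _ ⟨g, rfl⟩; exact misclassRisk_mem_Icc.1⟩

theorem excessRisk_nonneg [IsProbabilityMeasure P] (hf : Measurable f) : 0 ≤ excessRisk P f :=
  sub_nonneg.2 (ciInf_le bddBelow_misclassRisk ⟨f, hf⟩)

theorem excessRisk_le_one [IsProbabilityMeasure P] : excessRisk P f ≤ 1 := by
  have : 0 ≤ ⨅ g : {g : EuclideanSpace ℝ (Fin d) → Bool // Measurable g}, misclassRisk P g.1 :=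
    Real.iInf_nonneg fun g => misclassRisk_mem_Icc.1
  unfold excessRisk
  linarith [(misclassRisk_mem_Icc (P := P) (f := f)).2]

theorem IsRegressionFunction.ofReal_excessRisk_le [IsProbabilityMeasure P]
    (h : IsRegressionFunction P η) (hf : Measurable f) :
    ENNReal.ofReal (excessRisk P f) ≤ ∫⁻ x, pointRegret (η x) (f x) ∂P.fst := by
  have hfin : ∫⁻ x, pointRegret (η x) (f x) ∂P.fst ≠ ⊤ := by
    refine ne_top_of_le_ne_top ENNReal.one_ne_top
      ((lintegral_mono fun x => pointRegret_le_one (h.mem_unit x) (f x)).trans ?_)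
    simp
  rw [ENNReal.ofReal_le_iff_le_toReal hfin]
  have : Nonempty {g : EuclideanSpace ℝ (Fin d) → Bool // Measurable g} := ⟨⟨f, hf⟩⟩
  unfold excessRisk
  rw [sub_le_comm]
  refine le_ciInf fun g => ?_
  have h1 := ENNReal.toReal_mono (ENNReal.add_ne_top.2 ⟨measure_ne_top _ _, hfin⟩)
    (h.measure_misclass_le hf g.2)
  rw [ENNReal.toReal_add (measure_ne_top _ _) hfin] at h1
  simp only [misclassRisk, measureReal_def]
  linarith

/-- Integration of a pointwise error bound under the margin condition, over dyadic slices. -/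
theorem lintegral_le_of_margin {μ : Measure (EuclideanSpace ℝ (Fin d))} {α Cα C K δ : ℝ}
    (hη : Measurable η) (hCα : 0 < Cα) (hC : 0 < C) (hδ : 0 < δ) (hα : 0 ≤ α)
    (hK : α + 2 ≤ K) [IsFiniteMeasure μ]
    (hmargin : ∀ t : ℝ, 0 < t → μ.real {x | |η x - 1 / 2| ≤ t} ≤ Cα * t ^ α)
    {F : EuclideanSpace ℝ (Fin d) → ENNReal}
    (hF : ∀ᵐ x ∂μ, F x ≤ ENNReal.ofReal (2 * |η x - 1 / 2|) ∧ (0 < |η x - 1 / 2| →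
      F x ≤ ENNReal.ofReal (2 * |η x - 1 / 2| * (C * (|η x - 1 / 2| / δ) ^ (-K))))) :
    ∫⁻ x, F x ∂μ ≤ ENNReal.ofReal (4 * (1 + C) * 2 ^ K * Cα * δ ^ (1 + α)) := by
  -- A point of shell `l` is assigned to slice `l + 1`, but its error bound uses the lower end `2 ^
  -- l * δ`; the factor `2 ^ K` pays for this shift.
  let b : ℕ → ℝ := fun l => 2 * δ * (1 + C) * 2 ^ K * (2 ^ l) ^ (1 - K)
  have hb : ∀ l, 0 ≤ b l := fun l => by positivity
  let S : ℕ → Set (EuclideanSpace ℝ (Fin d)) := fun l => {x | |η x - 1 / 2| ≤ 2 ^ l * δ}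
  have hS : ∀ l, MeasurableSet (S l) := fun l =>
    measurableSet_le (hη.sub_const _).abs measurable_const
  have h2K : (1 : ℝ) ≤ 2 ^ K := Real.one_le_rpow (by norm_num) (by linarith)
  have hpt : ∀ᵐ x ∂μ, F x ≤ ∑' l, (S l).indicator (fun _ => ENNReal.ofReal (b l)) x := by
    filter_upwards [hF] with x hx
    set t := |η x - 1 / 2| with ht
    -- Below the resolution only the trivial bound is used, which also covers `t = 0`.
    rcases le_or_gt t δ with htδ | htδ
    · refine (hx.1.trans ?_).trans (ENNReal.le_tsum 0)
      have hmem : x ∈ S 0 := by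
        show |η x - 1 / 2| ≤ 2 ^ 0 * δ
        rwa [pow_zero, one_mul]
      rw [indicator_of_mem hmem]
      apply ENNReal.ofReal_le_ofReal
      have h1 : 2 * δ * 1 * 1 ≤ 2 * δ * (1 + C) * 2 ^ K := by
        gcongr
        linarith
      simp only [b, pow_zero, Real.one_rpow, mul_one]
      linarith
    · obtain ⟨l, hl1, hl2⟩ := exists_dyadic_shell hδ htδ
      have ht0 : 0 < t := hδ.trans htδ
      refine ((hx.2 ht0).trans ?_).trans (ENNReal.le_tsum (l + 1))
      rw [indicator_of_mem (show x ∈ S (l + 1) from hl2)]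
      apply ENNReal.ofReal_le_ofReal
      have h1 : (t / δ) ^ (-K) ≤ ((2 : ℝ) ^ l) ^ (-K) :=
        Real.rpow_le_rpow_of_nonpos (by positivity) ((le_div_iff₀ hδ).2 hl1.le) (by linarith)
      have h2 : ((2 : ℝ) ^ (l + 1)) ^ (1 - K) = 2 * 2 ^ l * ((2 ^ l) ^ (-K) * (2 ^ K)⁻¹) := by
        rw [sub_eq_add_neg, Real.rpow_add (by positivity), Real.rpow_one, pow_succ,
          Real.mul_rpow (by positivity) (by norm_num), Real.rpow_neg two_pos.le K]
        ring
      calc 2 * t * (C * (t / δ) ^ (-K)) ≤ 2 * (2 ^ (l + 1) * δ) * ((1 + C) * (2 ^ l) ^ (-K)) := by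
            gcongr
            linarith
        _ = b (l + 1) := by
            simp only [b]
            rw [h2]
            field_simp
            ring
  calc _ ≤ ∫⁻ x, ∑' l, (S l).indicator (fun _ => ENNReal.ofReal (b l)) x ∂μ :=
        lintegral_mono_ae hpt
    _ = ∑' l, ENNReal.ofReal (b l) * μ (S l) := by
        rw [lintegral_tsum fun l => (measurable_const.indicator (hS l)).aemeasurable]
        exact tsum_congr fun l => lintegral_indicator_const (hS l) _
    _ ≤ ∑' l : ℕ, ENNReal.ofReal (2 * (1 + C) * 2 ^ K * Cα * δ ^ (1 + α) * (1 / 2) ^ l) := by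
        refine ENNReal.tsum_le_tsum fun l => ?_
        have h1 : μ (S l) ≤ ENNReal.ofReal (Cα * (2 ^ l * δ) ^ α) := by
          rw [← ofReal_measureReal]
          exact ENNReal.ofReal_le_ofReal (hmargin _ (by positivity))
        refine (mul_le_mul_right h1 _).trans ?_
        rw [← ENNReal.ofReal_mul (hb l)]
        apply ENNReal.ofReal_le_ofReal
        have hp : (1 : ℝ) ≤ 2 ^ l := one_le_pow₀ (by norm_num)
        have h2 : ((2 : ℝ) ^ l) ^ (1 - K) * (2 ^ l) ^ α ≤ (1 / 2) ^ l := by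
          rw [← Real.rpow_add (by positivity)]
          calc ((2 : ℝ) ^ l) ^ (1 - K + α) ≤ (2 ^ l) ^ (-1 : ℝ) :=
                Real.rpow_le_rpow_of_exponent_le hp (by linarith)
            _ = (1 / 2) ^ l := by rw [Real.rpow_neg_one, one_div, inv_pow]
        calc b l * (Cα * (2 ^ l * δ) ^ α)
            = 2 * (1 + C) * 2 ^ K * Cα * δ ^ (1 + α) * ((2 ^ l) ^ (1 - K) * (2 ^ l) ^ α) := by
              simp only [b]
              rw [Real.mul_rpow (by positivity) hδ.le, Real.rpow_add hδ, Real.rpow_one]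
              ring
          _ ≤ _ := mul_le_mul_of_nonneg_left h2 (by positivity)
    _ = _ := by
        have hsum : Summable fun l : ℕ => 2 * (1 + C) * 2 ^ K * Cα * δ ^ (1 + α) * (1 / 2) ^ l :=
          summable_geometric_two.mul_left _
        rw [← ENNReal.ofReal_tsum_of_nonneg (fun l => by positivity) hsum, tsum_mul_left,
          tsum_geometric_two]
        ring_nf

end Risk

/-! ### From the pointwise vote error to the expected excess risk -/

section Expected

variable {d m : ℕ} {α β Cα Cβ μlo μhi cμ rμ : ℝ} {P : Fin (m + 1) → Measure (Obs d)}
  {η : Fin (m + 1) → EuclideanSpace ℝ (Fin d) → ℝ} {γ : Fin (m + 1) → ℝ} {n : Fin (m + 1) → ℕ}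

/-- A wrong decision of the classifier is a wrong weighted vote. -/
theorem vote_nonpos_of_wrongDecision {s : CrowdSample d m n} {x : EuclideanSpace ℝ (Fin d)} {u : ℝ}
    (hpos : 0 < ∑ i, voteWeight d β γ n i * (numNeighbors d β γ n i : ℝ))
    (h : WrongDecision u (vsnn β γ n s x)) :
    ∑ i, voteWeight d β γ n i * ((if 1 / 2 < u then 1 else -1) *
      (neighborLabelSum (s i) (numNeighbors d β γ n i) x - numNeighbors d β γ n i / 2)) ≤ 0 := by
  have hsum : ∀ σ : ℝ, ∑ i, voteWeight d β γ n i * (σ *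
      (neighborLabelSum (s i) (numNeighbors d β γ n i) x - numNeighbors d β γ n i / 2)) =
      σ * (∑ i, voteWeight d β γ n i * neighborLabelSum (s i) (numNeighbors d β γ n i) x -
        1 / 2 * ∑ i, voteWeight d β γ n i * (numNeighbors d β γ n i : ℝ)) := by
    intro σ
    rw [Finset.mul_sum, ← Finset.sum_sub_distrib, Finset.mul_sum]
    exact Finset.sum_congr rfl fun i _ => by ring
  rw [hsum]
  rcases h with ⟨hu, hv⟩ | ⟨hu, hv⟩
  · rw [if_pos hu]
    -- A tied vote is decided as `false`, which is why the event of a wrong vote is non-strict.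
    have hle := not_lt.1 (of_decide_eq_false hv)
    rw [vsnnRegression, div_le_iff₀ hpos] at hle
    linarith
  · rw [if_neg (by linarith)]
    have hlt := of_decide_eq_true hv
    rw [vsnnRegression, lt_div_iff₀ hpos] at hlt
    linarith

theorem measurable_excessRisk_vsnn [IsProbabilityMeasure (P 0)] :
    Measurable fun s : CrowdSample d m n => excessRisk (P 0) (vsnn β γ n s) := by
  have hset : MeasurableSet {q : CrowdSample d m n × Obs d | vsnn β γ n q.1 q.2.1 ≠ q.2.2} := by
    have h1 : Measurable fun q : CrowdSample d m n × Obs d => vsnn β γ n q.1 q.2.1 :=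
      (measurable_vsnn β γ n).comp (f := fun q : CrowdSample d m n × Obs d => (q.1, q.2.1))
        (by fun_prop)
    have h2 : Measurable fun q : CrowdSample d m n × Obs d => q.2.2 := by fun_prop
    exact (measurableSet_eq_fun h1 h2).compl
  have h3 : Measurable fun s : CrowdSample d m n =>
      (P 0 {z | vsnn β γ n s z.1 ≠ z.2}).toReal :=
    (measurable_measure_prodMk_left hset).ennreal_toReal
  exact h3.sub_const _

/-- A bound for the probability of a wrong vote at a point yields a bound for the expected excess
risk. -/
theorem IsRegularCrowd.integral_excessRisk_le
    (hreg : IsRegularCrowd α β Cα Cβ μlo μhi cμ rμ P η) {C K δ : ℝ} (hα : 0 ≤ α) (hCα : 0 < Cα)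
    (hC : 0 < C) (hδ : 0 < δ) (hK : α + 2 ≤ K)
    (hpos : 0 < ∑ i, voteWeight d β γ n i * (numNeighbors d β γ n i : ℝ))
    (hvote : ∀ x ∈ (P 0).fst.support, ∀ σ : ℝ, |σ| = 1 →
      σ * (η 0 x - 1 / 2) = |η 0 x - 1 / 2| → 0 < |η 0 x - 1 / 2| →
      crowdLaw n P {s | ∑ i, voteWeight d β γ n i * (σ * (neighborLabelSum (s i)
        (numNeighbors d β γ n i) x - numNeighbors d β γ n i / 2)) ≤ 0} ≤
        ENNReal.ofReal (C * (|η 0 x - 1 / 2| / δ) ^ (-K))) :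
    Integrable (fun s => excessRisk (P 0) (vsnn β γ n s)) (crowdLaw n P) ∧
    ∫ s, excessRisk (P 0) (vsnn β γ n s) ∂(crowdLaw n P) ≤
      4 * (1 + C) * 2 ^ K * Cα * δ ^ (1 + α) := by
  have hprob := hreg.prob
  have hv := measurable_vsnn (d := d) β γ n
  have hvs : ∀ s : CrowdSample d m n, Measurable (vsnn β γ n s) := fun s =>
    hv.comp (f := fun x => (s, x)) measurable_prodMk_left
  have hmeas := measurable_excessRisk_vsnn (P := P) (β := β) (γ := γ) (n := n)
  have hint : Integrable (fun s => excessRisk (P 0) (vsnn β γ n s)) (crowdLaw n P) :=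
    Integrable.of_mem_Icc 0 1 hmeas.aemeasurable
      (Filter.Eventually.of_forall fun s => ⟨excessRisk_nonneg (hvs s), excessRisk_le_one⟩)
  refine ⟨hint, ?_⟩
  rw [integral_eq_lintegral_of_nonneg_ae
    (Filter.Eventually.of_forall fun s => excessRisk_nonneg (hvs s)) hmeas.aestronglyMeasurable]
  refine ENNReal.toReal_le_of_le_ofReal (by positivity) ?_
  have hr : Measurable fun q : CrowdSample d m n × EuclideanSpace ℝ (Fin d) =>
      pointRegret (η 0 q.2) (vsnn β γ n q.1 q.2) :=
    measurable_pointRegret ((hreg.regression 0).measurable.comp measurable_snd) hv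
  calc _ ≤ ∫⁻ s, ∫⁻ x, pointRegret (η 0 x) (vsnn β γ n s x) ∂(P 0).fst ∂(crowdLaw n P) :=
        lintegral_mono fun s => (hreg.regression 0).ofReal_excessRisk_le (hvs s)
    _ = ∫⁻ x, ∫⁻ s, pointRegret (η 0 x) (vsnn β γ n s x) ∂(crowdLaw n P) ∂(P 0).fst :=
        lintegral_lintegral_swap hr.aemeasurable
    _ ≤ _ := by
        refine lintegral_le_of_margin (hreg.regression 0).measurable hCα hC hδ hα hK hreg.margin
          ((hreg.ae_mem_support 0).mono fun x hx => ?_)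
        have hWm : MeasurableSet {s | WrongDecision (η 0 x) (vsnn β γ n s x)} :=
          measurableSet_wrongDecision measurable_const (hv.comp (f := fun s => (s, x)) measurable_prodMk_right)
        have heq : ∫⁻ s, pointRegret (η 0 x) (vsnn β γ n s x) ∂(crowdLaw n P) =
            ENNReal.ofReal (2 * |η 0 x - 1 / 2|) *
              crowdLaw n P {s | WrongDecision (η 0 x) (vsnn β γ n s x)} := by
          rw [← lintegral_indicator_const hWm]
          refine lintegral_congr fun s => ?_
          simp only [pointRegret, indicator, mem_ofPred_eq]
        rw [heq]
        refine ⟨(mul_le_mul' le_rfl prob_le_one).trans (mul_one _).le, fun ht => ?_⟩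
        rw [ENNReal.ofReal_mul (p := 2 * |η 0 x - 1 / 2|) (by positivity)]
        refine mul_le_mul_right ?_ _
        refine le_trans (measure_mono fun s hs => vote_nonpos_of_wrongDecision hpos hs)
          (hvote x hx (if 1 / 2 < η 0 x then 1 else -1) ?_ ?_ ht)
        · split_ifs <;> simp
        · split_ifs with hη
          · rw [one_mul, abs_of_pos (by linarith)]
          · rw [neg_one_mul, abs_of_nonpos (by linarith)]

end Expected

/-! ### Sample sizes and weights -/

section Sizes

variable {d m : ℕ} {β : ℝ} {γ : Fin (m + 1) → ℝ} {n : Fin (m + 1) → ℕ}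

theorem one_le_effSize (hβ : 0 < β) (hγ : ∀ i, 0 < γ i) (h : 0 < sizeRatio d β γ n) :
    1 ≤ effSize d β γ n := by
  obtain ⟨i, hi⟩ : ∃ i, n i ≠ 0 := by
    by_contra! hn
    simp [sizeRatio, hn] at h
  have h1 : (1 : ℝ) ≤ (n i : ℝ) ^ ((2 * β + d) / (2 * γ i * β + d)) := by
    refine Real.one_le_rpow (by exact_mod_cast Nat.one_le_iff_ne_zero.2 hi) ?_
    have := hγ i
    positivity
  exact h1.trans (Finset.single_le_sum
    (f := fun i => (n i : ℝ) ^ ((2 * β + d) / (2 * γ i * β + d)))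
    (fun i _ => by positivity) (Finset.mem_univ i))

/-- The bias that the classifier can resolve. -/
noncomputable def resolution (d : ℕ) (β : ℝ) (γ : Fin (m + 1) → ℝ) (n : Fin (m + 1) → ℕ) : ℝ :=
  effSize d β γ n ^ (-(β / (2 * β + d)))

theorem resolution_rpow (hN : 0 ≤ effSize d β γ n) (a : ℝ) :
    resolution d β γ n ^ a = effSize d β γ n ^ (-(a * β / (2 * β + d))) := by
  rw [resolution, ← Real.rpow_mul hN]
  congr 1
  ring

theorem resolution_pos (hN : 1 ≤ effSize d β γ n) : 0 < resolution d β γ n :=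
  Real.rpow_pos_of_pos (by linarith) _

theorem resolution_le_one (hβ : 0 < β) (hN : 1 ≤ effSize d β γ n) : resolution d β γ n ≤ 1 :=
  Real.rpow_le_one_of_one_le_of_nonpos hN (neg_nonpos.2 (by positivity))

theorem voteWeight_eq (hN : 1 ≤ effSize d β γ n) (i : Fin (m + 1)) :
    voteWeight d β γ n i = resolution d β γ n ^ γ i :=
  (resolution_rpow (by linarith) _).symm

theorem numNeighbors_eq (hβ : 0 < β) (hN : 1 ≤ effSize d β γ n) (i : Fin (m + 1)) :
    numNeighbors d β γ n i = ⌊(n i : ℝ) * resolution d β γ n ^ ((d : ℝ) / β)⌋₊ := by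
  rw [numNeighbors, resolution_rpow (by linarith), div_mul_cancel₀ _ hβ.ne']

/-- The sample-size functional is the variance term of the vote with the neighbour counts before
rounding. -/
theorem sizeRatio_eq (hβ : 0 < β) (hN : 1 ≤ effSize d β γ n) :
    sizeRatio d β γ n = ∑ i, (n i : ℝ) * resolution d β γ n ^ ((d : ℝ) / β) *
      voteWeight d β γ n i ^ 2 := by
  unfold sizeRatio
  refine Finset.sum_congr rfl fun i _ => ?_
  have hN0 : 0 < effSize d β γ n := by linarith
  rw [resolution_rpow hN0.le, div_mul_cancel₀ _ hβ.ne', voteWeight, ← Real.rpow_natCast _ 2,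
    ← Real.rpow_mul hN0.le, mul_assoc (n i : ℝ), ← Real.rpow_add hN0, div_eq_mul_inv, ← Real.rpow_neg hN0.le]
  congr 2
  push_cast
  ring

theorem numNeighbors_le (hβ : 0 < β) (hN : 1 ≤ effSize d β γ n) (i : Fin (m + 1)) :
    (numNeighbors d β γ n i : ℝ) ≤ n i * resolution d β γ n ^ ((d : ℝ) / β) := by
  rw [numNeighbors_eq hβ hN]
  have := resolution_pos hN
  exact Nat.floor_le (by positivity)

theorem numNeighbors_le_card (hβ : 0 < β) (hN : 1 ≤ effSize d β γ n) (i : Fin (m + 1)) :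
    numNeighbors d β γ n i ≤ n i := by
  have h1 := numNeighbors_le hβ hN i
  have h2 : resolution d β γ n ^ ((d : ℝ) / β) ≤ 1 :=
    Real.rpow_le_one (resolution_pos hN).le (resolution_le_one hβ hN) (by positivity)
  have h3 : (numNeighbors d β γ n i : ℝ) ≤ n i :=
    h1.trans (mul_le_of_le_one_right (Nat.cast_nonneg _) h2)
  exact_mod_cast h3

/-- The sources with a large exponent and at least one vote have a small total weight. -/
theorem sum_voteWeight_le_one (hβ : 0 < β) (hγ : ∀ i, 0 < γ i) (hN : 1 ≤ effSize d β γ n) :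
    ∑ i, ({i | 2 + (d : ℝ) / β < γ i} ∩ {i | 0 < numNeighbors d β γ n i}).indicator
      (voteWeight d β γ n) i ≤ 1 := by
  have hN0 : 0 < effSize d β γ n := by linarith
  calc _ ≤ ∑ i, (n i : ℝ) ^ ((2 * β + d) / (2 * γ i * β + d)) / effSize d β γ n := by
        refine Finset.sum_le_sum fun i _ => ?_
        refine indicator_apply_le' (fun hi => ?_) fun _ => by positivity
        -- A source that votes has data, so its own summand in the effective size is at least `1`.
        have hn : 1 ≤ n i :=
          (Nat.one_le_iff_ne_zero.2 (Nat.pos_iff_ne_zero.1 hi.2)).trans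
            (numNeighbors_le_card hβ hN i)
        have h1 : (1 : ℝ) ≤ (n i : ℝ) ^ ((2 * β + d) / (2 * γ i * β + d)) := by
          refine Real.one_le_rpow (by exact_mod_cast hn) ?_
          have := hγ i
          positivity
        -- The threshold `2 + d / β` is where the exponent `γ i * β / (2β + d)` reaches `1`.
        have h2 : voteWeight d β γ n i ≤ 1 / effSize d β γ n := by
          rw [one_div, ← Real.rpow_neg_one]
          refine Real.rpow_le_rpow_of_exponent_le hN (neg_le_neg ?_)
          rw [le_div_iff₀ (by positivity)]
          have h3 : (2 + (d : ℝ) / β) * β = 2 * β + d := by field_simp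
          have h4 : 2 + (d : ℝ) / β < γ i := hi.1
          nlinarith
        exact h2.trans (by gcongr)
    _ = 1 := by
        rw [← Finset.sum_div]
        exact div_self hN0.ne'

end Sizes

/-! ### The flipping-rate model and the upper bound -/

theorem flippedRegression_sub_half (C γ u : ℝ) :
    flippedRegression (workerAccuracy C γ u) (workerAccuracy C γ u) u - 1 / 2 =
      C * |u - 1 / 2| ^ (γ - 1) * (u - 1 / 2) := by
  unfold flippedRegression workerAccuracy
  ring

theorem abs_flippedRegression_sub_half {C γ : ℝ} (hC : 0 ≤ C) (hγ : 0 < γ) (u : ℝ) :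
    |flippedRegression (workerAccuracy C γ u) (workerAccuracy C γ u) u - 1 / 2| =
      C * |u - 1 / 2| ^ γ := by
  rw [flippedRegression_sub_half, abs_mul, abs_mul, abs_of_nonneg hC,
    abs_of_nonneg (Real.rpow_nonneg (abs_nonneg _) _)]
  rcases (abs_nonneg (u - 1 / 2)).eq_or_lt with h | h
  -- At `u = 1/2` the value of `0 ^ (γ - 1)` is irrelevant, being multiplied by zero.
  · rw [← h, Real.zero_rpow hγ.ne']
    simp
  · rw [mul_assoc, ← Real.rpow_add_one h.ne', sub_add_cancel]

theorem mainTheorem8 (d : ℕ) (hd : 0 < d)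
    (α β Cα Cβ μlo μhi cμ rμ γlo Cγlo CL CU : ℝ)
    (hα : 0 ≤ α) (hβ : 0 < β) (hCα : 0 < Cα) (hCβ : 0 < Cβ)
    (hμlo : 0 < μlo) (hμ : μlo < μhi) (hcμ : 0 < cμ) (hrμ : 0 < rμ)
    (hγlo : 0 < γlo) (hCγlo : 0 < Cγlo) (hCL : 0 < CL) (hCU : CL < CU) :
    ∃ C : ℝ, 0 < C ∧ ∃ ε : ℝ, 0 < ε ∧
      ∀ (m : ℕ) (γ Cγ : Fin (m + 1) → ℝ) (n : Fin (m + 1) → ℕ),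
        γ 0 = 1 → Cγ 0 = 1 → (∀ i, γlo ≤ γ i) → (∀ i, Cγlo ≤ Cγ i) →
        CL < sizeRatio d β γ n → sizeRatio d β γ n < CU →
        (CL < ∑ i, (numNeighbors d β γ n i : ℝ) * voteWeight d β γ n i ^ 2 →
          WorstCaseExcessRiskLE β γ n
            (FlipClass (d := d) α β Cα Cβ μlo μhi cμ rμ γ Cγ)
            (C * effSize d β γ n ^ (-(β * (1 + α) / (2 * β + d))))) ∧
        (∑ i, voteWeight d β γ n i ≤ ε →
          WorstCaseExcessRiskLE β γ n
            (DriftClass (d := d) α β Cα Cβ μlo μhi cμ rμ γ Cγ)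
            (C * effSize d β γ n ^ (-(β * (1 + α) / (2 * β + d))))) := by
  -- Large enough for both geometric series: `α + 2 ≤ K` for the margin slices and `γmax + 1 ≤ K`
  -- for the bias shells, with `γmax = 2 + d / β`.
  set K : ℝ := α + (2 + (d : ℝ) / β) + 2 with hK_def
  have hdβ : 0 < (d : ℝ) / β := by positivity
  obtain ⟨C, hC, hvote⟩ := exists_vote_error_le (d := d) (v := CL / 2) (γmax := 2 + (d : ℝ) / β)
    (K := K) hd hβ hCβ hμlo hcμ hrμ hγlo hCγlo (by positivity) (by positivity) (by linarith)
  -- In `ε`, the bound `1` controls the total weight of the sources in `A`, and `CL / 2` the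
  -- variance lost by rounding.
  refine ⟨4 * (1 + C) * 2 ^ K * Cα, by positivity, min 1 (CL / 2),
    lt_min one_pos (by positivity), ?_⟩
  intro m γ Cγ n _ _ hγ hCγ hratio _
  have hγ0 : ∀ i, 0 < γ i := fun i => hγlo.trans_le (hγ i)
  have hCγ0 : ∀ i, 0 < Cγ i := fun i => hCγlo.trans_le (hCγ i)
  have hN := one_le_effSize (d := d) hβ hγ0 (hCL.trans hratio)
  have hδ := resolution_pos hN
  have hrate : effSize d β γ n ^ (-(β * (1 + α) / (2 * β + d))) =
      resolution d β γ n ^ (1 + α) := by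
    rw [resolution_rpow (by linarith), mul_comm]
  have hw0 : ∀ i, 0 < voteWeight d β γ n i := fun i => by
    rw [voteWeight_eq hN]
    positivity
  have hw1 : ∀ i, voteWeight d β γ n i ≤ 1 := fun i => by
    rw [voteWeight_eq hN]
    exact Real.rpow_le_one hδ.le (resolution_le_one hβ hN) (hγ0 i).le
  rw [hrate]
  have hpos : CL / 2 ≤ ∑ i, (numNeighbors d β γ n i : ℝ) * voteWeight d β γ n i ^ 2 →
      0 < ∑ i, voteWeight d β γ n i * (numNeighbors d β γ n i : ℝ) := by
    intro hV
    refine lt_of_lt_of_le (show 0 < CL / 2 by positivity) (hV.trans ?_)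
    refine Finset.sum_le_sum fun i _ => ?_
    rw [mul_comm]
    refine mul_le_mul_of_nonneg_right ?_ (Nat.cast_nonneg _)
    rw [sq]
    exact mul_le_of_le_one_right (hw0 i).le (hw1 i)
  constructor
  · rintro hV P ⟨η, hreg, hflip⟩
    have hV' : CL / 2 ≤ ∑ i, (numNeighbors d β γ n i : ℝ) * voteWeight d β γ n i ^ 2 := by
      linarith
    refine hreg.integral_excessRisk_le hα hCα hC hδ (by linarith) (hpos hV') ?_
    refine hvote (A := {i | 2 + (d : ℝ) / β < γ i}) hδ hγ hCγ (numNeighbors_le_card hβ hN)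
      (numNeighbors_le hβ hN) (voteWeight_eq hN) hV' (sum_voteWeight_le_one hβ hγ0 hN)
      (fun i hi => not_lt.1 hi) hreg (fun i y hy => ?_) fun i _ y hy => ?_
    · rw [hflip i y hy]
      refine ⟨?_, (abs_flippedRegression_sub_half (hCγ0 i).le (hγ0 i) _).ge⟩
      rw [flippedRegression_sub_half, mul_assoc]
      exact mul_nonneg (mul_nonneg (hCγ0 i).le (by positivity)) (mul_self_nonneg _)
    · rw [hflip i y hy]
      exact (abs_flippedRegression_sub_half (hCγ0 i).le (hγ0 i) _).le
  · rintro hε P ⟨η, hreg, hdrift⟩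
    have hV' : CL / 2 ≤ ∑ i, (numNeighbors d β γ n i : ℝ) * voteWeight d β γ n i ^ 2 := by
      -- Rounding removes less than one neighbour per source, at a cost of at most `w i ^ 2 ≤ w i`.
      have h1 : sizeRatio d β γ n - ∑ i, voteWeight d β γ n i ≤
          ∑ i, (numNeighbors d β γ n i : ℝ) * voteWeight d β γ n i ^ 2 := by
        rw [sizeRatio_eq hβ hN, ← Finset.sum_sub_distrib]
        refine Finset.sum_le_sum fun i _ => ?_
        have h2 := Nat.lt_floor_add_one ((n i : ℝ) * resolution d β γ n ^ ((d : ℝ) / β))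
        rw [← numNeighbors_eq hβ hN] at h2
        have h3 := mul_le_mul_of_nonneg_right h2.le (sq_nonneg (voteWeight d β γ n i))
        have h4 := mul_le_of_le_one_right (hw0 i).le (hw1 i)
        linarith [sq (voteWeight d β γ n i)]
      have h5 := hε.trans (min_le_right _ _)
      linarith
    refine hreg.integral_excessRisk_le hα hCα hC hδ (by linarith) (hpos hV') ?_
    -- The drift class gives no upper bound on the workers' signals, so every source is treated as
    -- arbitrary.
    refine hvote (A := univ) hδ hγ hCγ (numNeighbors_le_card hβ hN) (numNeighbors_le hβ hN)
      (voteWeight_eq hN) hV' ?_ (fun i hi => absurd (mem_univ i) hi) hreg hdrift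
      fun i hi => absurd (mem_univ i) hi
    refine le_trans (Finset.sum_le_sum fun i _ => ?_) (hε.trans (min_le_left _ _))
    exact indicator_le_self' (fun i _ => (hw0 i).le) i
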